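/- A split graph is a finite simple graph whose vertex set can be partitioned into a clique and an independent set (with arbitrary edges between them; either part may be empty). \textsc{Split Addition} (resp. \textsc{Split Deletion}) is the following problem: given a finite simple graph $G$ and an integer $k \in \mathbb{N}$, is there a set $F$ of at most $k$ edges such that $G+F$, the graph on $V(G)$ with edge set $E(G)\cup F$ (resp. $G-F$, the graph on $V(G)$ with edge set $E(G)\setminus F$), is a split graph? Theorem. Each of the problems \textsc{Split Addition} and \textsc{Split Deletion}, parameterized by $k$, admits a kernel with at most $11k+6\sqrt{2k}+4$ vertices. That is, for each of the two problems there is an algorithm that, given an instance $(G,k)$, computes in time polynomial in the size of the instance (the number of bits of the adjacency matrix of $G$ and of the binary representation of $k$) an instance $(G',k')$ of the same problem such that $(G',k')$ is a positive instance if and only if $(G,k)$ is, $G'$ has at most $11k+6\sqrt{2k}+4$ vertices, and $k'\le k$. -/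

import Mathlib

/-! ### Split graphs and the two edge modification problems -/

/-- `G` is a split graph: its vertex set is partitioned into a clique `K` and an independent set
(either part may be empty; edges between the parts are arbitrary). -/
def IsSplitGraph {V : Type*} (G : SimpleGraph V) : Prop :=
  ∃ K : Set V, G.IsClique K ∧ G.IsIndepSet Kᶜ

/-- An instance `(G, k)` of a parameterized graph problem: a finite graph on the vertices
`0, …, n - 1`, and the parameter `k`. -/
structure GraphInstance where
  n : ℕ
  graph : SimpleGraph (Fin n)
  k : ℕ

/-- `Split Addition`: is there a set `F` of at most `k` edges such that `G + F` is a split graph? -/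
def SplitAddition (I : GraphInstance) : Prop :=
  ∃ F : Finset (Sym2 (Fin I.n)), (∀ e ∈ F, ¬ e.IsDiag) ∧ F.card ≤ I.k ∧
    IsSplitGraph (I.graph ⊔ SimpleGraph.fromEdgeSet (F : Set (Sym2 (Fin I.n))))

/-- `Split Deletion`: is there a set `F` of at most `k` edges of `G` such that `G - F` is a split
graph? -/
def SplitDeletion (I : GraphInstance) : Prop :=
  ∃ F : Finset (Sym2 (Fin I.n)), (∀ e ∈ F, e ∈ I.graph.edgeSet) ∧ F.card ≤ I.k ∧
    IsSplitGraph (I.graph.deleteEdges (F : Set (Sym2 (Fin I.n))))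

/-! ### A random access machine with a step count

Structured programs over finitely many registers and finitely many arrays of natural numbers (a
program mentions only finitely many of each). The arithmetic operations are addition and truncated
subtraction, at unit cost; there is no multiplication, so that `t` steps can increase the bit
length of the numbers in memory only by `O(t)`, and polynomial time on this machine is polynomial
time on Turing machines. -/

namespace RAM

/-- A memory state: the contents of the registers and of the arrays. -/
structure State where
  reg : ℕ → ℕ
  arr : ℕ → ℕ → ℕ

/-- Arithmetic expressions. -/
inductive Exp where
  /-- a numeral -/
  | const (c : ℕ)
  /-- the contents of a register -/
  | reg (r : ℕ)
  /-- the entry of array `a` at the index that is the value of `i` -/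
  | get (a : ℕ) (i : Exp)
  | add (e f : Exp)
  /-- truncated subtraction -/
  | sub (e f : Exp)

/-- The value of an expression. -/
def Exp.eval (σ : State) : Exp → ℕ
  | .const c => c
  | .reg r => σ.reg r
  | .get a i => σ.arr a (i.eval σ)
  | .add e f => e.eval σ + f.eval σ
  | .sub e f => e.eval σ - f.eval σ

/-- The number of steps that the evaluation of an expression takes: one for each numeral, each
register access, each array access and each arithmetic operation. -/
def Exp.cost : Exp → ℕ
  | .const _ => 1
  | .reg _ => 1
  | .get _ i => i.cost + 1
  | .add e f => e.cost + f.cost + 1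
  | .sub e f => e.cost + f.cost + 1

/-- Programs. -/
inductive Prog where
  | skip
  /-- register `r` := `e` -/
  | set (r : ℕ) (e : Exp)
  /-- array `a` at index `i` := `e` -/
  | put (a : ℕ) (i e : Exp)
  | seq (c d : Prog)
  /-- if `e ≠ 0` then `c` else `d` -/
  | cond (e : Exp) (c d : Prog)
  /-- while `e ≠ 0` do `c` -/
  | loop (e : Exp) (c : Prog)

/-- Writing to a register. -/
def State.setReg (σ : State) (r x : ℕ) : State :=
  { σ with reg := Function.update σ.reg r x }

/-- Writing to an array entry. -/
def State.setArr (σ : State) (a i x : ℕ) : State :=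
  { σ with arr := Function.update σ.arr a (Function.update (σ.arr a) i x) }

/-- `Exec c σ t τ`: started in state `σ`, the program `c` halts after exactly `t` steps in
state `τ`. -/
inductive Exec : Prog → State → ℕ → State → Prop where
  | skip (σ : State) : Exec .skip σ 1 σ
  | set (r : ℕ) (e : Exp) (σ : State) :
      Exec (.set r e) σ (e.cost + 1) (σ.setReg r (e.eval σ))
  | put (a : ℕ) (i e : Exp) (σ : State) :
      Exec (.put a i e) σ (i.cost + e.cost + 1) (σ.setArr a (i.eval σ) (e.eval σ))
  | seq {c d : Prog} {σ τ ρ : State} {s t : ℕ} (hc : Exec c σ s τ) (hd : Exec d τ t ρ) :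
      Exec (.seq c d) σ (s + t) ρ
  | cond_true {e : Exp} {c d : Prog} {σ τ : State} {t : ℕ} (he : e.eval σ ≠ 0)
      (hc : Exec c σ t τ) : Exec (.cond e c d) σ (e.cost + 1 + t) τ
  | cond_false {e : Exp} {c d : Prog} {σ τ : State} {t : ℕ} (he : e.eval σ = 0)
      (hd : Exec d σ t τ) : Exec (.cond e c d) σ (e.cost + 1 + t) τ
  | loop_true {e : Exp} {c : Prog} {σ τ ρ : State} {s t : ℕ} (he : e.eval σ ≠ 0)
      (hc : Exec c σ s τ) (hl : Exec (.loop e c) τ t ρ) :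
      Exec (.loop e c) σ (e.cost + 1 + s + t) ρ
  | loop_false {e : Exp} {c : Prog} {σ : State} (he : e.eval σ = 0) :
      Exec (.loop e c) σ (e.cost + 1) σ

end RAM

/-! ### Instances in memory, and kernels -/

namespace GraphInstance

open Classical in
/-- The input state that presents `(G, k)`: register `0` holds the number `n` of vertices,
register `1` holds `k`, array `0` holds the adjacency matrix, row after row, and everything else
is `0`. -/
noncomputable def inputState (I : GraphInstance) : RAM.State where
  reg r := if r = 0 then I.n else if r = 1 then I.k else 0
  arr a i :=
    if a = 0 ∧ ∃ u v : Fin I.n, i = (u : ℕ) * I.n + (v : ℕ) ∧ I.graph.Adj u v then 1 else 0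

open Classical in
/-- The instance `(G, k)` is the output that is presented by a final state: register `0` holds the
number of vertices, register `1` holds `k`, and array `1` holds the adjacency matrix, row after
row. -/
def IsOutput (I : GraphInstance) (σ : RAM.State) : Prop :=
  σ.reg 0 = I.n ∧ σ.reg 1 = I.k ∧
    ∀ u v : Fin I.n, σ.arr 1 ((u : ℕ) * I.n + (v : ℕ)) = if I.graph.Adj u v then 1 else 0

/-- The size of an instance in bits: the entries of the adjacency matrix and the binary digits of
the parameter. -/
def size (I : GraphInstance) : ℕ := I.n ^ 2 + Nat.size I.k

end GraphInstance

/-- The parameterized problem `Q` admits a kernel with at most `f k` vertices: one program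
transforms every instance `(G, k)`, in time polynomial in the size of the instance, into an
instance `(G', k')` of `Q` that is equivalent to it, has at most `f k` vertices, and has
`k' ≤ k`. -/
def AdmitsKernel (Q : GraphInstance → Prop) (f : ℕ → ℝ) : Prop :=
  ∃ (c : RAM.Prog) (p : Polynomial ℕ), ∀ I : GraphInstance,
    ∃ (J : GraphInstance) (t : ℕ) (σ : RAM.State),
      RAM.Exec c I.inputState t σ ∧ t ≤ p.eval I.size ∧ J.IsOutput σ ∧
      (Q J ↔ Q I) ∧ (J.n : ℝ) ≤ f I.k ∧ J.k ≤ I.k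

/-! ### Bounded executions -/

namespace RAM

/-! Complements of split graphs are split, and complementation exchanges deletion with addition. So
one kernelization for `SplitAddition`, complemented at both ends if necessary, serves both problems.
A solution amounts to a set `C` with independent complement in which at most `k` edges are missing
(`SplitKernel.exists_isSol_iff`).

Some vertices have the same position in every solution. A vertex whose neighbourhood misses more
than `k` edges lies in `C`. A vertex lies outside `C` if more than `k` of its nonneighbours each
have more than `k` neighbours among its nonneighbours; the neighbours of such a vertex lie in `C`.
Of the remaining, free vertices, those without a free neighbour can stay outside `C`. Those with a
free neighbour (the linked ones) that have no nonneighbour among the forced-in and linked vertices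
can join `C` at no cost. The rest is the core. It matters only through its induced graph and through
the number of forced-in nonneighbours of each vertex. A clique of `k + 1` vertices, guarded by an
independent set of `k + 2` vertices, reproduces these numbers up to `k + 1`, beyond which they are
prohibitive; the parameter drops by the number of non-edges between forced-in vertices
(`IsGadget.exists_isSol_iff`).

In a positive instance the core has at most `9 * k + 1` vertices (`card_core_le`): the neighbourhood
of a free vertex of `C` misses at most `k` edges, and double counting over these neighbourhoods
bounds the non-edges between the free vertices of `C` and the linked vertices outside `C`. With the
`2 * k + 3` gadget vertices this gives `11 * k + 4`, so the square root term is slack. If the core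
is larger, or if too many edges are missing between forced-in vertices, the output is two disjoint
edges with parameter `0`.

For the running time, the construction is written as a list of tables whose entries are arithmetic
terms with bounded sums, and such terms compile to programs whose running time is polynomial in the
values of the variables and of the array entries read. As `k` may be exponential in the size of the
instance, it is first replaced by `min k (n ^ 2)`. -/

@[simp] theorem State.setReg_reg (σ : State) (r x s : ℕ) :
    (σ.setReg r x).reg s = if s = r then x else σ.reg s := by
  simp [State.setReg, Function.update_apply]

@[simp] theorem State.setReg_arr (σ : State) (r x : ℕ) : (σ.setReg r x).arr = σ.arr := rfl

@[simp] theorem State.setArr_reg (σ : State) (a i x : ℕ) : (σ.setArr a i x).reg = σ.reg := rfl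

theorem State.setArr_arr (σ : State) (a i x b j : ℕ) :
    (σ.setArr a i x).arr b j = if b = a ∧ j = i then x else σ.arr b j := by
  by_cases h : b = a
  · subst h; simp [State.setArr, Function.update_apply]
  · simp [State.setArr, h]

/-- Started in `σ`, the program `c` halts after at most `B` steps in a state that satisfies `Q`. -/
def Runs (c : Prog) (σ : State) (B : ℕ) (Q : State → Prop) : Prop :=
  ∃ τ T, Exec c σ T τ ∧ T ≤ B ∧ Q τ

theorem Runs.mono {c : Prog} {σ : State} {B B' : ℕ} {Q Q' : State → Prop} (h : Runs c σ B Q)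
    (hB : B ≤ B') (hQ : ∀ τ, Q τ → Q' τ) : Runs c σ B' Q' := by
  obtain ⟨τ, T, h1, h2, h3⟩ := h
  exact ⟨τ, T, h1, h2.trans hB, hQ _ h3⟩

theorem Runs.seq {c d : Prog} {σ : State} {B B' : ℕ} {R Q : State → Prop} (h : Runs c σ B R)
    (h' : ∀ τ, R τ → Runs d τ B' Q) : Runs (.seq c d) σ (B + B') Q := by
  obtain ⟨τ, T, h1, h2, h3⟩ := h
  obtain ⟨ρ, T', h4, h5, h6⟩ := h' τ h3
  exact ⟨ρ, T + T', .seq h1 h4, add_le_add h2 h5, h6⟩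

theorem runs_set {r : ℕ} {e : Exp} {σ : State} {Q : State → Prop}
    (h : Q (σ.setReg r (e.eval σ))) : Runs (.set r e) σ (e.cost + 1) Q :=
  ⟨_, _, .set r e σ, le_rfl, h⟩

theorem runs_put {a : ℕ} {i e : Exp} {σ : State} {Q : State → Prop}
    (h : Q (σ.setArr a (i.eval σ) (e.eval σ))) : Runs (.put a i e) σ (i.cost + e.cost + 1) Q :=
  ⟨_, _, .put a i e σ, le_rfl, h⟩

/-- A loop that makes `N` iterations, with the invariant `Φ i` before iteration `i`. -/
theorem runs_loop {e : Exp} {c : Prog} (N B : ℕ) (Φ : ℕ → State → Prop)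
    (hstep : ∀ i < N, ∀ σ, Φ i σ → e.eval σ ≠ 0 ∧ Runs c σ B (Φ (i + 1)))
    (hend : ∀ σ, Φ N σ → e.eval σ = 0) {σ : State} (hσ : Φ 0 σ) :
    Runs (.loop e c) σ (N * (e.cost + 1 + B) + (e.cost + 1)) (Φ N) := by
  suffices h : ∀ j i, i + j = N → ∀ σ, Φ i σ →
      Runs (.loop e c) σ (j * (e.cost + 1 + B) + (e.cost + 1)) (Φ N) from h N 0 (by simp) σ hσ
  intro j
  induction j with
  | zero =>
    intro i hi σ hσ
    obtain rfl : i = N := by simpa using hi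
    exact ⟨σ, _, .loop_false (hend σ hσ), by simp, hσ⟩
  | succ j ih =>
    intro i hi σ hσ
    obtain ⟨he, τ, T, h1, h2, h3⟩ := hstep i (by omega) σ hσ
    obtain ⟨ρ, T', h4, h5, h6⟩ := ih (i + 1) (by omega) τ h3
    refine ⟨ρ, _, .loop_true he h1 h4, ?_, h6⟩
    rw [Nat.succ_mul]
    omega

/-! ### Terms with bounded sums -/

/-- Arithmetic terms with bounded summation; `sum x b t` is `∑ x < b, t`. -/
inductive Term where
  | const (c : ℕ)
  | var (r : ℕ)
  | get (a : ℕ) (t : Term)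
  | add (s t : Term)
  | sub (s t : Term)
  | mul (s t : Term)
  | sum (x : ℕ) (b t : Term)

namespace Term

/-- The value of a term. -/
def eval (α : ℕ → ℕ → ℕ) : (ℕ → ℕ) → Term → ℕ
  | _, .const c => c
  | ρ, .var r => ρ r
  | ρ, .get a t => α a (t.eval α ρ)
  | ρ, .add s t => s.eval α ρ + t.eval α ρ
  | ρ, .sub s t => s.eval α ρ - t.eval α ρ
  | ρ, .mul s t => s.eval α ρ * t.eval α ρ
  | ρ, .sum x b t => ∑ i ∈ Finset.range (b.eval α ρ), t.eval α (Function.update ρ x i)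

/-- The term uses only variables below `m`, and reads only arrays in `S`. -/
def wf (m : ℕ) (S : List ℕ) : Term → Bool
  | .const _ => true
  | .var r => decide (r < m)
  | .get a t => S.contains a && t.wf m S
  | .add s t => s.wf m S && t.wf m S
  | .sub s t => s.wf m S && t.wf m S
  | .mul s t => s.wf m S && t.wf m S
  | .sum x b t => decide (x < m) && b.wf m S && t.wf m S

theorem eval_congr {m : ℕ} {S : List ℕ} {α β : ℕ → ℕ → ℕ} (hα : ∀ a ∈ S, α a = β a) (t : Term) :
    ∀ {ρ π : ℕ → ℕ}, t.wf m S → (∀ r < m, ρ r = π r) → t.eval α ρ = t.eval β π := by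
  induction t with
  | const c => intros; rfl
  | var r => intro ρ π h hr; exact hr r (by simpa [wf] using h)
  | get a t ih =>
    intro ρ π h hr
    simp only [wf, Bool.and_eq_true, List.contains_iff_mem] at h
    simp only [eval, ih h.2 hr, hα a h.1]
  | add s t ihs iht | sub s t ihs iht | mul s t ihs iht =>
    intro ρ π h hr
    simp only [wf, Bool.and_eq_true] at h
    simp only [eval, ihs h.1 hr, iht h.2 hr]
  | sum x b t ihb iht =>
    intro ρ π h hr
    simp only [wf, Bool.and_eq_true, decide_eq_true_eq] at h
    simp only [eval, ihb h.1.2 hr]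
    refine Finset.sum_congr rfl fun i _ => iht h.2 fun r hrm => ?_
    by_cases hx : r = x
    · subst hx; simp
    · simp [hx, hr r hrm]

/-- A program that writes the value of a term to register `d`, and leaves the registers below `d`
unchanged. -/
def compile : Term → ℕ → Prog
  | .const c, d => .set d (.const c)
  | .var r, d => .set d (.reg r)
  | .get a t, d => .seq (t.compile d) (.set d (.get a (.reg d)))
  | .add s t, d =>
    .seq (s.compile d) (.seq (t.compile (d + 1)) (.set d (.add (.reg d) (.reg (d + 1)))))
  | .sub s t, d =>
    .seq (s.compile d) (.seq (t.compile (d + 1)) (.set d (.sub (.reg d) (.reg (d + 1)))))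
  | .mul s t, d =>
    .seq (s.compile d) (.seq (t.compile (d + 1)) (.seq (.set (d + 2) (.const 0))
      (.seq (.loop (.reg d) (.seq (.set (d + 2) (.add (.reg (d + 2)) (.reg (d + 1))))
        (.set d (.sub (.reg d) (.const 1))))) (.set d (.reg (d + 2))))))
  | .sum x b t, d =>
    -- Register `d` holds the bound, `d + 1` saves the old value of `x`, and `d + 2` accumulates the
    -- sum; hence the body is compiled at `d + 3`.
    .seq (b.compile d) (.seq (.set (d + 1) (.reg x)) (.seq (.set (d + 2) (.const 0))
      (.seq (.set x (.const 0)) (.seq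
        (.loop (.sub (.reg d) (.reg x)) (.seq (t.compile (d + 3))
          (.seq (.set (d + 2) (.add (.reg (d + 2)) (.reg (d + 3))))
            (.set x (.add (.reg x) (.const 1))))))
        (.seq (.set x (.reg (d + 1))) (.set d (.reg (d + 2))))))))

end Term

/-- The registers below `m` and the entries of the arrays in `S` are at most `X`. -/
def State.BoundedBy (σ : State) (m : ℕ) (S : List ℕ) (X : ℕ) : Prop :=
  (∀ r < m, σ.reg r ≤ X) ∧ ∀ a ∈ S, ∀ i, σ.arr a i ≤ X

/-- `τ` agrees with `σ` on the registers below `d` and on the arrays. -/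
def State.Agree (d : ℕ) (σ τ : State) : Prop :=
  (∀ r < d, τ.reg r = σ.reg r) ∧ τ.arr = σ.arr

theorem State.Agree.bounded {d m X : ℕ} {S : List ℕ} {σ τ : State} (h : State.Agree d σ τ)
    (hm : m ≤ d) (hσ : σ.BoundedBy m S X) : τ.BoundedBy m S X :=
  ⟨fun r hr => by rw [h.1 r (by omega)]; exact hσ.1 r hr, fun a ha i => by
    rw [h.2]; exact hσ.2 a ha i⟩

theorem State.Agree.eval {d m : ℕ} {S : List ℕ} {σ τ : State} (h : State.Agree d σ τ) (hm : m ≤ d)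
    {t : Term} (ht : t.wf m S) : t.eval τ.arr τ.reg = t.eval σ.arr σ.reg := by
  rw [h.2]; exact Term.eval_congr (fun _ _ => rfl) t ht fun r hr => h.1 r (by omega)

theorem State.Agree.trans {d e : ℕ} {σ τ ρ : State} (h : State.Agree d σ τ)
    (h' : State.Agree e τ ρ) (hde : d ≤ e) : State.Agree d σ ρ :=
  ⟨fun r hr => (h'.1 r (by omega)).trans (h.1 r hr), by
    rw [h'.2]
    exact h.2⟩

/-- The specification of a compiled term: the value and the running time are at most `B`. -/
def Computes (t : Term) (m B : ℕ) (σ : State) : Prop :=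
  t.eval σ.arr σ.reg ≤ B ∧ ∀ d, m ≤ d →
    Runs (t.compile d) σ B fun τ => τ.reg d = t.eval σ.arr σ.reg ∧ State.Agree d σ τ

theorem Computes.mono {t : Term} {m B B' : ℕ} {σ : State} (h : Computes t m B σ) (hB : B ≤ B') :
    Computes t m B' σ :=
  ⟨h.1.trans hB, fun d hd => (h.2 d hd).mono hB fun _ => id⟩

/-! ### The cost of arithmetic operations and of bounded sums -/

theorem computes_binary {m : ℕ} {S : List ℕ} {s t u : Term} {P Q : ℕ} {σ : State}
    (ht : t.wf m S) (hs' : Computes s m P σ)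
    (ht' : ∀ τ, State.Agree m σ τ → Computes t m Q τ) (op : Exp → Exp → Exp) (f : ℕ → ℕ → ℕ)
    (hop : ∀ σ a b, (op (.reg a) (.reg b)).eval σ = f (σ.reg a) (σ.reg b))
    (hcost : ∀ a b, (op (.reg a) (.reg b)).cost = 3)
    (hu : ∀ d, u.compile d =
      .seq (s.compile d) (.seq (t.compile (d + 1)) (.set d (op (.reg d) (.reg (d + 1))))))
    (hue : u.eval σ.arr σ.reg = f (s.eval σ.arr σ.reg) (t.eval σ.arr σ.reg))
    (hf : ∀ a b, f a b ≤ a + b) :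
    Computes u m (P + (Q + 4)) σ := by
  constructor
  · have h1 := hs'.1
    have h2 := (ht' σ ⟨fun _ _ => rfl, rfl⟩).1
    have := hf (s.eval σ.arr σ.reg) (t.eval σ.arr σ.reg)
    rw [hue]; omega
  · intro d hd
    rw [hu, hue]
    refine (hs'.2 d hd).seq fun τ hτ => ((ht' τ ⟨fun r hr => hτ.2.1 r (by omega), hτ.2.2⟩).2 (d + 1)
      (by omega)).seq fun τ' hτ' => ?_
    refine (runs_set ?_).mono (by rw [hcost]) fun _ => id
    refine ⟨?_, fun r hr => ?_, ?_⟩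
    · simp only [State.setReg_reg, if_true, hop, hτ'.1, hτ'.2.1 d (by omega), hτ.1,
        hτ.2.eval hd ht]
    · rw [State.setReg_reg, if_neg (by omega), hτ'.2.1 r (by omega), hτ.2.1 r hr]
    · rw [State.setReg_arr, hτ'.2.2, hτ.2.2]

/-- The machine has no multiplication, so the product is a repeated addition. The time is linear in
the value of the first factor, which is why the bounds throughout concern values and not bit
lengths. -/
theorem computes_mul {m : ℕ} {S : List ℕ} {s t : Term} {P Q : ℕ} {σ : State}
    (ht : t.wf m S) (hs' : Computes s m P σ)
    (ht' : ∀ τ, State.Agree m σ τ → Computes t m Q τ) :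
    Computes (.mul s t) m (P * Q + P + Q + 10 + P * 10) σ := by
  have h1 := hs'.1
  have h2 := (ht' σ ⟨fun _ _ => rfl, rfl⟩).1
  constructor
  · have := Nat.mul_le_mul h1 h2
    simp only [Term.eval]; omega
  · intro d hd
    simp only [Term.compile]
    refine Runs.mono (B := P + (Q + (2 + ((s.eval σ.arr σ.reg * (1 + 1 + (4 + 4)) + (1 + 1)) + 2))))
      ((hs'.2 d hd).seq fun τ hτ => ((ht' τ ⟨fun r hr => hτ.2.1 r (by omega), hτ.2.2⟩).2 (d + 1)
      (by omega)).seq fun τ' hτ' => (runs_set (Q := fun τ => τ.reg d = s.eval σ.arr σ.reg ∧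
        τ.reg (d + 1) = t.eval σ.arr σ.reg ∧ τ.reg (d + 2) = 0 ∧ State.Agree d σ τ) ?_).seq
      fun τ₂ hτ₂ => (runs_loop (s.eval σ.arr σ.reg) (4 + 4) (fun i τ =>
        τ.reg d = s.eval σ.arr σ.reg - i ∧ τ.reg (d + 1) = t.eval σ.arr σ.reg ∧
        τ.reg (d + 2) = i * t.eval σ.arr σ.reg ∧ State.Agree d σ τ) ?_ ?_ ?_).seq
      fun τ₃ hτ₃ => runs_set ?_) ?_ fun _ => id
    · refine ⟨?_, ?_, ?_, ?_, ?_⟩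
      · simp [hτ'.2.1 d (by omega), hτ.1]
      · simp [hτ'.1, hτ.2.eval hd ht]
      · simp [Exp.eval]
      · intro r hr
        rw [State.setReg_reg, if_neg (by omega), hτ'.2.1 r (by omega), hτ.2.1 r hr]
      · rw [State.setReg_arr, hτ'.2.2, hτ.2.2]
    · rintro i hi ρ ⟨h1, h2, h3, h4⟩
      refine ⟨by simp only [Exp.eval]; omega, (runs_set ?_).seq fun _ h => runs_set h⟩
      refine ⟨?_, ?_, ?_, ?_, ?_⟩
      · simp [Exp.eval, h1]; omega
      · simp [h2]
      · simp [Exp.eval, h2, h3, Nat.succ_mul]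
      · intro r hr
        simp only [State.setReg_reg]
        rw [if_neg (by omega), if_neg (by omega), h4.1 r hr]
      · simp [h4.2]
    · rintro ρ ⟨h1, -⟩
      simp [Exp.eval, h1]
    · obtain ⟨h1, h2, h3, h4⟩ := hτ₂
      exact ⟨by simp [h1], h2, by simp [h3], h4⟩
    · obtain ⟨h1, h2, h3, h4⟩ := hτ₃
      refine ⟨by simp [Exp.eval, Term.eval, h3], fun r hr => ?_, by simp [h4.2]⟩
      rw [State.setReg_reg, if_neg (by omega), h4.1 r hr]
    · have := Nat.mul_le_mul_right 10 h1
      omega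

theorem computes_sum {m : ℕ} {S : List ℕ} {x : ℕ} {b t : Term} {P Q : ℕ} {σ : State} (hx : x < m)
    (ht : t.wf m S) (hb' : Computes b m P σ)
    (ht' : ∀ τ i, i ≤ b.eval σ.arr σ.reg → τ.reg x = i → (∀ r < m, r ≠ x → τ.reg r = σ.reg r) →
      τ.arr = σ.arr → Computes t m Q τ) :
    Computes (.sum x b t) m (P + P * Q + P * 12 + 14) σ := by
  have h1 := hb'.1
  have hval : ∀ τ : State, ∀ i, τ.reg x = i → (∀ r < m, r ≠ x → τ.reg r = σ.reg r) →
      τ.arr = σ.arr → t.eval τ.arr τ.reg = t.eval σ.arr (Function.update σ.reg x i) := by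
    intro τ i h1 h2 h3
    rw [h3]
    refine Term.eval_congr (fun _ _ => rfl) t ht fun r hr => ?_
    by_cases hrx : r = x
    · subst hrx; simp [h1]
    · simp [hrx, h2 r hr hrx]
  constructor
  · have h2 : ∀ i ∈ Finset.range (b.eval σ.arr σ.reg),
        t.eval σ.arr (Function.update σ.reg x i) ≤ Q := by
      intro i hi
      exact (ht' ⟨Function.update σ.reg x i, σ.arr⟩ i (Finset.mem_range.1 hi).le (by simp)
        (fun r _ hr => by simp [hr]) rfl).1
    have h3 := Finset.sum_le_card_nsmul _ _ _ h2
    rw [Finset.card_range, smul_eq_mul] at h3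
    have h4 := Nat.mul_le_mul_right Q h1
    simp only [Term.eval]; omega
  · intro d hd
    simp only [Term.compile]
    refine Runs.mono (B := P + (2 + (2 + (2 + ((b.eval σ.arr σ.reg * (3 + 1 + (Q + (4 + 4))) +
        (3 + 1)) + (2 + 2))))))
      ((hb'.2 d hd).seq fun τ hτ => (runs_set (Q := fun τ => τ.reg d = b.eval σ.arr σ.reg ∧
        τ.reg (d + 1) = σ.reg x ∧ State.Agree d σ τ) ?_).seq
      fun τ₁ hτ₁ => (runs_set (Q := fun τ => τ.reg d = b.eval σ.arr σ.reg ∧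
        τ.reg (d + 1) = σ.reg x ∧ τ.reg (d + 2) = 0 ∧ State.Agree d σ τ) ?_).seq
      fun τ₂ hτ₂ => (runs_set (Q := fun τ => τ.reg d = b.eval σ.arr σ.reg ∧
        τ.reg (d + 1) = σ.reg x ∧ τ.reg (d + 2) = 0 ∧ τ.reg x = 0 ∧
        (∀ r < d, r ≠ x → τ.reg r = σ.reg r) ∧ τ.arr = σ.arr) ?_).seq
      fun τ₃ hτ₃ => (runs_loop (b.eval σ.arr σ.reg) (Q + (4 + 4)) (fun i τ =>
        τ.reg d = b.eval σ.arr σ.reg ∧ τ.reg (d + 1) = σ.reg x ∧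
        τ.reg (d + 2) = ∑ j ∈ Finset.range i, t.eval σ.arr (Function.update σ.reg x j) ∧
        τ.reg x = i ∧ (∀ r < d, r ≠ x → τ.reg r = σ.reg r) ∧ τ.arr = σ.arr) ?_ ?_ ?_).seq
      fun τ₄ hτ₄ => (runs_set (Q := fun τ => τ.reg (d + 2) = Term.eval σ.arr σ.reg (.sum x b t) ∧
        State.Agree d σ τ) ?_).seq
      fun τ₅ hτ₅ => runs_set ?_) ?_ fun _ => id
    · refine ⟨by simp [hτ.1], by simp [Exp.eval, hτ.2.1 x (by omega)], fun r hr => ?_,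
        by simp [hτ.2.2]⟩
      rw [State.setReg_reg, if_neg (by omega), hτ.2.1 r hr]
    · obtain ⟨h1, h2, h3⟩ := hτ₁
      refine ⟨by simp [h1], by simp [h2], by simp [Exp.eval], fun r hr => ?_, by simp [h3.2]⟩
      rw [State.setReg_reg, if_neg (by omega), h3.1 r hr]
    · obtain ⟨h1, h2, h3, h4⟩ := hτ₂
      refine ⟨?_, ?_, ?_, by simp [Exp.eval], fun r hr hrx => ?_, by simp [h4.2]⟩
      · rw [State.setReg_reg, if_neg (by omega), h1]
      · rw [State.setReg_reg, if_neg (by omega), h2]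
      · rw [State.setReg_reg, if_neg (by omega), h3]
      · rw [State.setReg_reg, if_neg hrx, h4.1 r hr]
    · rintro i hi ρ ⟨h1, h2, h3, h4, h5, h6⟩
      refine ⟨by simp only [Exp.eval]; omega, (((ht' ρ i hi.le h4 (fun r hr => h5 r (by omega)) h6).2
        (d + 3) (by omega)).seq fun ρ' hρ' => (runs_set (Q := fun τ =>
        τ.reg d = b.eval σ.arr σ.reg ∧ τ.reg (d + 1) = σ.reg x ∧
        τ.reg (d + 2) = ∑ j ∈ Finset.range (i + 1), t.eval σ.arr (Function.update σ.reg x j) ∧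
        τ.reg x = i ∧ (∀ r < d, r ≠ x → τ.reg r = σ.reg r) ∧ τ.arr = σ.arr) ?_).seq
        fun ρ'' hρ'' => runs_set ?_)⟩
      · have hv := hval ρ i h4 (fun r hr => h5 r (by omega)) h6
        obtain ⟨h7, h8, h9⟩ := hρ'
        refine ⟨?_, ?_, ?_, ?_, fun r hr hrx => ?_, ?_⟩
        · rw [State.setReg_reg, if_neg (by omega), h8 _ (by omega), h1]
        · rw [State.setReg_reg, if_neg (by omega), h8 _ (by omega), h2]
        · simp only [State.setReg_reg, if_true, Exp.eval]
          rw [h8 _ (by omega), h3, h7, hv, Finset.sum_range_succ]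
        · rw [State.setReg_reg, if_neg (by omega), h8 _ (by omega), h4]
        · rw [State.setReg_reg, if_neg (by omega), h8 _ (by omega), h5 r hr hrx]
        · rw [State.setReg_arr, h9, h6]
      · obtain ⟨h1, h2, h3, h4, h5, h6⟩ := hρ''
        refine ⟨?_, ?_, ?_, by simp [Exp.eval, h4], fun r hr hrx => ?_, by simp [h6]⟩
        · rw [State.setReg_reg, if_neg (by omega), h1]
        · rw [State.setReg_reg, if_neg (by omega), h2]
        · rw [State.setReg_reg, if_neg (by omega), h3]
        · rw [State.setReg_reg, if_neg hrx, h5 r hr hrx]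
    · rintro ρ ⟨h1, h2, h3, h4, -⟩
      simp [Exp.eval, h1, h4]
    · obtain ⟨h1, h2, h3, h4, h5, h6⟩ := hτ₃
      exact ⟨h1, h2, by simp [h3], h4, h5, h6⟩
    · obtain ⟨h1, h2, h3, h4, h5, h6⟩ := hτ₄
      refine ⟨?_, fun r hr => ?_, by simp [h6]⟩
      · rw [State.setReg_reg, if_neg (by omega), h3, Term.eval]
      · by_cases hrx : r = x
        · subst hrx; simp [Exp.eval, h2]
        · rw [State.setReg_reg, if_neg hrx, h5 r hr hrx]
    · refine ⟨by simp [Exp.eval, hτ₅.1], fun r hr => ?_, by simp [hτ₅.2.2]⟩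
      rw [State.setReg_reg, if_neg (by omega), hτ₅.2.1 r hr]
    · have h5 : b.eval σ.arr σ.reg * (3 + 1 + (Q + (4 + 4))) ≤ P * (Q + 12) :=
        Nat.mul_le_mul h1 (by omega)
      rw [Nat.mul_add P] at h5
      omega

/-- Terms are evaluated in polynomial time. -/
theorem exists_polynomial_computes {m : ℕ} {S : List ℕ} (t : Term) (ht : t.wf m S) :
    ∃ P : Polynomial ℕ, ∀ X σ, State.BoundedBy σ m S X → Computes t m (P.eval X) σ := by
  induction t with
  | const c =>
    refine ⟨.C (c + 2), fun X σ _ => ⟨by simp [Term.eval], fun d _ => ?_⟩⟩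
    exact (runs_set ⟨by simp [Exp.eval, Term.eval],
      fun r hr => by rw [State.setReg_reg, if_neg (by omega)], rfl⟩).mono
      (by simp [Exp.cost]) fun _ => id
  | var r =>
    simp only [Term.wf, decide_eq_true_eq] at ht
    refine ⟨.X + .C 2, fun X σ hσ => ⟨?_, fun d _ => ?_⟩⟩
    · have := hσ.1 r ht
      simp [Term.eval]; omega
    · exact (runs_set ⟨by simp [Exp.eval, Term.eval],
        fun r hr => by rw [State.setReg_reg, if_neg (by omega)], rfl⟩).mono
        (by simp [Exp.cost]) fun _ => id
  | get a t ih =>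
    simp only [Term.wf, Bool.and_eq_true, List.contains_iff_mem] at ht
    obtain ⟨P, hP⟩ := ih ht.2
    refine ⟨P + .X + .C 3, fun X σ hσ => ⟨?_, fun d hd => ?_⟩⟩
    · have := hσ.2 a ht.1 (t.eval σ.arr σ.reg)
      simp [Term.eval]; omega
    · refine (((hP X σ hσ).2 d hd).seq fun τ hτ => runs_set ⟨?_, fun r hr => ?_, ?_⟩).mono
        (by simp [Exp.cost]) fun _ => id
      · simp [Exp.eval, Term.eval, hτ.1, hτ.2.2]
      · rw [State.setReg_reg, if_neg (by omega), hτ.2.1 r hr]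
      · simp [hτ.2.2]
  | add s t ihs iht =>
    simp only [Term.wf, Bool.and_eq_true] at ht
    obtain ⟨P, hP⟩ := ihs ht.1
    obtain ⟨Q, hQ⟩ := iht ht.2
    refine ⟨P + (Q + .C 4), fun X σ hσ => ?_⟩
    simp only [Polynomial.eval_add, Polynomial.eval_C]
    exact computes_binary ht.2 (hP X σ hσ) (fun τ hτ => hQ X τ (hτ.bounded le_rfl hσ)) Exp.add
      (· + ·) (fun _ _ _ => rfl) (fun _ _ => rfl) (fun _ => rfl) rfl fun _ _ => le_rfl
  | sub s t ihs iht =>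
    simp only [Term.wf, Bool.and_eq_true] at ht
    obtain ⟨P, hP⟩ := ihs ht.1
    obtain ⟨Q, hQ⟩ := iht ht.2
    refine ⟨P + (Q + .C 4), fun X σ hσ => ?_⟩
    simp only [Polynomial.eval_add, Polynomial.eval_C]
    exact computes_binary ht.2 (hP X σ hσ) (fun τ hτ => hQ X τ (hτ.bounded le_rfl hσ)) Exp.sub
      (· - ·) (fun _ _ _ => rfl) (fun _ _ => rfl) (fun _ => rfl) rfl
      fun a b => (Nat.sub_le a b).trans (Nat.le_add_right a b)
  | mul s t ihs iht =>
    simp only [Term.wf, Bool.and_eq_true] at ht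
    obtain ⟨P, hP⟩ := ihs ht.1
    obtain ⟨Q, hQ⟩ := iht ht.2
    refine ⟨P * Q + P + Q + .C 10 + P * .C 10, fun X σ hσ => ?_⟩
    simp only [Polynomial.eval_add, Polynomial.eval_mul, Polynomial.eval_C]
    exact computes_mul ht.2 (hP X σ hσ) (fun τ hτ => hQ X τ (hτ.bounded le_rfl hσ))
  | sum x b t ihb iht =>
    simp only [Term.wf, Bool.and_eq_true, decide_eq_true_eq] at ht
    obtain ⟨P, hP⟩ := ihb ht.1.2
    obtain ⟨Q, hQ⟩ := iht ht.2
    -- Inside the sum the index variable can be as large as the bound of the sum, hence at most `P`;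
    -- so the body runs in a state bounded by `X + P`.
    refine ⟨P + P * Q.comp (.X + P) + P * .C 12 + .C 14, fun X σ hσ => ?_⟩
    simp only [Polynomial.eval_add, Polynomial.eval_mul, Polynomial.eval_C, Polynomial.eval_comp,
      Polynomial.eval_X]
    refine computes_sum ht.1.1 ht.2 (hP X σ hσ) fun τ i hi h1 h2 h3 => hQ _ τ ⟨fun r hr => ?_, ?_⟩
    · by_cases hrx : r = x
      · have := (hP X σ hσ).1
        rw [hrx, h1]; omega
      · rw [h2 r hr hrx]; exact (hσ.1 r hr).trans (Nat.le_add_right _ _)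
    · intro a ha i
      rw [h3]; exact (hσ.2 a ha i).trans (Nat.le_add_right _ _)

/-! ### Tables -/

/-- The instruction to fill the array `arr` below `bound` with the values of `body`, in which the
variable `2` stands for the index. -/
structure Table where
  arr : ℕ
  bound : Term
  body : Term

/-- The program for a table. -/
def Table.prog (T : Table) (m : ℕ) : Prog :=
  .seq (T.bound.compile m) (.seq (.set 2 (.const 0)) (.seq
    (.loop (.sub (.reg m) (.reg 2)) (.seq (T.body.compile (m + 1))
      (.seq (.put T.arr (.reg 2) (.reg (m + 1))) (.set 2 (.add (.reg 2) (.const 1))))))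
    (.set 2 (.const 0))))

/-- The body never reads the array that is being filled, so writing an entry does not disturb the
later ones, and the prescribed equations can be stated in the final state. -/
theorem Table.exists_polynomial_runs {m : ℕ} (hm : 2 < m) {S : List ℕ} (T : Table)
    (hT : T.arr ∉ S) (hb : T.bound.wf m S) (ht : T.body.wf m S) :
    ∃ P : Polynomial ℕ, ∀ X σ, (∀ r < m, σ.reg r ≤ X) → (∀ a i, σ.arr a i ≤ X) → σ.reg 2 = 0 →
      Runs (T.prog m) σ (P.eval X) fun τ => (∀ a i, τ.arr a i ≤ P.eval X) ∧
        (∀ r < m, τ.reg r = σ.reg r) ∧ (∀ a, a ≠ T.arr → τ.arr a = σ.arr a) ∧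
        ∀ i < T.bound.eval τ.arr σ.reg,
          τ.arr T.arr i = T.body.eval τ.arr (Function.update σ.reg 2 i) := by
  obtain ⟨P, hP⟩ := exists_polynomial_computes T.bound hb
  obtain ⟨Q, hQ⟩ := exists_polynomial_computes T.body ht
  -- The last two summands bound the array entries afterwards; the others bound the running time.
  refine ⟨P + (.C 2 + ((P * (.C 4 + (Q.comp (.X + P) + (.C 3 + .C 4))) + .C 4) + .C 2)) + .X +
    Q.comp (.X + P), fun X σ hr hα hσ2 => ?_⟩
  simp only [Polynomial.eval_add, Polynomial.eval_mul, Polynomial.eval_C, Polynomial.eval_comp,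
      Polynomial.eval_X]
  have hPb := hP X σ ⟨hr, fun a _ => hα a⟩
  set p := P.eval X
  set q := Q.eval (X + p)
  set N := T.bound.eval σ.arr σ.reg with hN
  have hNp : N ≤ p := hPb.1
  have hbody : ∀ α : ℕ → ℕ → ℕ, ∀ π : ℕ → ℕ, ∀ i, (∀ a, a ≠ T.arr → α a = σ.arr a) → π 2 = i →
      (∀ r < m, r ≠ 2 → π r = σ.reg r) →
      T.body.eval α π = T.body.eval σ.arr (Function.update σ.reg 2 i) := by
    intro α π i h1 h2 h3
    refine Term.eval_congr (fun a ha => h1 a fun h => hT (h ▸ ha)) _ ht fun r hr => ?_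
    by_cases hr2 : r = 2
    · subst hr2; simp [h2]
    · simp [hr2, h3 r hr hr2]
  have hbound : ∀ α : ℕ → ℕ → ℕ, (∀ a, a ≠ T.arr → α a = σ.arr a) →
      T.bound.eval α σ.reg = N := fun α h1 =>
    Term.eval_congr (fun a ha => h1 a fun h => hT (h ▸ ha)) _ hb fun r hr => rfl
  refine Runs.mono (B := p + (2 + ((N * (3 + 1 + (q + (3 + 4))) + (3 + 1)) + 2)))
    ((hPb.2 m le_rfl).seq fun τ hτ => (runs_set (Q := fun τ => τ.reg m = N ∧ τ.reg 2 = 0 ∧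
      State.Agree m σ τ) ?_).seq
    fun τ₁ hτ₁ => (runs_loop N (q + (3 + 4)) (fun i τ => τ.reg m = N ∧ τ.reg 2 = i ∧
      (∀ r < m, r ≠ 2 → τ.reg r = σ.reg r) ∧ (∀ a, a ≠ T.arr → τ.arr a = σ.arr a) ∧
      (∀ a i, τ.arr a i ≤ X + q) ∧
      ∀ j < i, τ.arr T.arr j = T.body.eval σ.arr (Function.update σ.reg 2 j)) ?_ ?_ ?_).seq
    fun τ₂ hτ₂ => runs_set ?_) ?_ fun _ => id
  · refine ⟨?_, by simp [Exp.eval], fun r hr => ?_, by simp [hτ.2.2]⟩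
    · rw [State.setReg_reg, if_neg (by omega), hτ.1]
    · by_cases hr2 : r = 2
      · simp [hr2, Exp.eval, hσ2]
      · rw [State.setReg_reg, if_neg hr2, hτ.2.1 r hr]
  · rintro i hi ρ ⟨h1, h2, h3, h4, h5, h6⟩
    have hQρ := hQ (X + p) ρ ⟨fun r hrm => ?_, fun a ha i => ?_⟩
    · have hv := hbody ρ.arr ρ.reg i h4 h2 h3
      refine ⟨by simp only [Exp.eval]; omega, ((hQρ.2 (m + 1) (by omega)).seq fun ρ' hρ' =>
        (runs_put (Q := fun τ => τ.reg m = N ∧ τ.reg 2 = i ∧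
        (∀ r < m, r ≠ 2 → τ.reg r = σ.reg r) ∧ (∀ a, a ≠ T.arr → τ.arr a = σ.arr a) ∧
        (∀ a i, τ.arr a i ≤ X + q) ∧
        ∀ j < i + 1, τ.arr T.arr j = T.body.eval σ.arr (Function.update σ.reg 2 j)) ?_).seq
        fun ρ'' hρ'' => runs_set ?_)⟩
      · obtain ⟨g1, g2, g3⟩ := hρ'
        have hi2 : ρ'.reg 2 = i := by rw [g2 2 (by omega), h2]
        refine ⟨?_, hi2, fun r hr hr2 => ?_, fun a ha => ?_, fun a j => ?_, fun j hj => ?_⟩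
        · rw [State.setArr_reg, g2 m (by omega), h1]
        · rw [State.setArr_reg, g2 r (by omega), h3 r hr hr2]
        · funext j
          rw [State.setArr_arr, if_neg (fun h => ha h.1), g3, h4 a ha]
        · rw [State.setArr_arr]
          split_ifs
          · have := hQρ.1
            simp only [Exp.eval, g1]; omega
          · rw [g3]; exact h5 a j
        · rw [State.setArr_arr]
          simp only [Exp.eval, hi2, true_and]
          split_ifs with hji
          · rw [g1, hv, hji]
          · rw [g3]; exact h6 j (by omega)
      · obtain ⟨g1, g2, g3, g4, g5, g6⟩ := hρ''
        refine ⟨?_, by simp [Exp.eval, g2], fun r hr hr2 => ?_, g4, g5, g6⟩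
        · rw [State.setReg_reg, if_neg (by omega), g1]
        · rw [State.setReg_reg, if_neg hr2, g3 r hr hr2]
    · by_cases hr2 : r = 2
      · rw [hr2, h2]; omega
      · rw [h3 r hrm hr2]; exact (hr r hrm).trans (Nat.le_add_right _ _)
    · rw [h4 a fun h => hT (h ▸ ha)]; exact (hα a i).trans (Nat.le_add_right _ _)
  · rintro ρ ⟨h1, h2, -⟩
    simp [Exp.eval, h1, h2]
  · obtain ⟨h1, h2, h3⟩ := hτ₁
    exact ⟨h1, h2, fun r hr _ => h3.1 r hr, fun a _ => by rw [h3.2],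
      fun a i => by rw [h3.2]; exact (hα a i).trans (Nat.le_add_right _ _),
      fun j hj => absurd hj (Nat.not_lt_zero j)⟩
  · obtain ⟨h1, h2, h3, h4, h5, h6⟩ := hτ₂
    refine ⟨fun a i => ?_, fun r hr => ?_, fun a ha => by simp [h4 a ha], fun i hi => ?_⟩
    · have := h5 a i
      simp only [State.setReg_arr]; omega
    · by_cases hr2 : r = 2
      · simp [hr2, Exp.eval, hσ2]
      · rw [State.setReg_reg, if_neg hr2, h3 r hr hr2]
    · simp only [State.setReg_arr] at hi ⊢
      rw [hbound _ h4] at hi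
      rw [h6 i hi, hbody _ _ i h4 (by simp) fun r _ hr => by simp [hr]]
  · have h5 : N * (3 + 1 + (q + (3 + 4))) ≤ p * (4 + (q + (3 + 4))) :=
      Nat.mul_le_mul hNp (by omega)
    omega

/-- The program for a list of tables. -/
def tablesProg (m : ℕ) : List Table → Prog
  | [] => .skip
  | T :: L => .seq (T.prog m) (tablesProg m L)

/-- Every table reads only the arrays in `S` and the earlier tables, and no array is written
twice. -/
def tablesWf (m : ℕ) : List ℕ → List Table → Bool
  | _, [] => true
  | S, T :: L => !S.contains T.arr && T.bound.wf m S && T.body.wf m S && tablesWf m (T.arr :: S) L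

/-- A list of tables is filled in polynomial time, and afterwards all the tables have the values
that are prescribed. -/
theorem exists_polynomial_runs_tablesProg {m : ℕ} (hm : 2 < m) (L : List Table) :
    ∀ S : List ℕ, tablesWf m S L → ∃ P : Polynomial ℕ, ∀ X σ,
      (∀ r < m, σ.reg r ≤ X) → (∀ a i, σ.arr a i ≤ X) → σ.reg 2 = 0 →
      Runs (tablesProg m L) σ (P.eval X) fun τ => (∀ r < m, τ.reg r = σ.reg r) ∧
        (∀ a ∈ S, τ.arr a = σ.arr a) ∧ ∀ π : ℕ → ℕ, (∀ r < m, π r = σ.reg r) →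
          ∀ T ∈ L, ∀ i < T.bound.eval τ.arr π,
            τ.arr T.arr i = T.body.eval τ.arr (Function.update π 2 i) := by
  induction L with
  | nil =>
    intro S _
    exact ⟨.C 1, fun X σ _ _ _ => ⟨σ, 1, .skip σ, by simp, fun _ _ => rfl, fun _ _ => rfl,
      by simp⟩⟩
  | cons T L ih =>
    intro S hS
    simp only [tablesWf, Bool.and_eq_true, Bool.not_eq_true', List.contains_eq_mem,
      decide_eq_false_iff_not] at hS
    obtain ⟨⟨⟨h1, h2⟩, h3⟩, h4⟩ := hS
    obtain ⟨P, hP⟩ := T.exists_polynomial_runs hm h1 h2 h3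
    obtain ⟨Q, hQ⟩ := ih _ h4
    refine ⟨P + Q.comp (.X + P), fun X σ hr hα hσ2 => ?_⟩
    simp only [Polynomial.eval_add, Polynomial.eval_comp, Polynomial.eval_X]
    refine (hP X σ hr hα hσ2).seq fun τ ⟨g1, g2, g3, g4⟩ => (hQ (X + P.eval X) τ (fun r hrm => ?_)
      (fun a i => (g1 a i).trans (Nat.le_add_left _ _)) (by rw [g2 2 hm, hσ2])).mono le_rfl
      fun ρ ⟨f1, f2, f3⟩ => ⟨fun r hrm => (f1 r hrm).trans (g2 r hrm), fun a ha => ?_, ?_⟩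
    · rw [g2 r hrm]; exact (hr r hrm).trans (Nat.le_add_right _ _)
    · rw [f2 a (List.mem_cons_of_mem _ ha), g3 a fun h => h1 (h ▸ ha)]
    · have hS : ∀ a ∈ S, ρ.arr a = τ.arr a := fun a ha => f2 a (List.mem_cons_of_mem _ ha)
      intro π hπ T' hT' i hi
      rcases List.mem_cons.1 hT' with rfl | hT'
      · rw [Term.eval_congr hS _ h2 hπ] at hi
        rw [f2 _ List.mem_cons_self, g4 i hi]
        refine (Term.eval_congr hS _ h3 fun r hrm => ?_).symm
        simp only [Function.update_apply, hπ r hrm]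
      · exact f3 π (fun r hrm => (hπ r hrm).trans (g2 r hrm).symm) T' hT' i hi

end RAM

/-! ### Non-edges inside a set of vertices -/

namespace SplitKernel

open Finset

section Abstract

variable {V : Type*} [DecidableEq V] (G : SimpleGraph V) [DecidableRel G.Adj]

/-- The vertices of `S` that are different from `v` and not adjacent to `v`. -/
def nonNbr (v : V) (S : Finset V) : Finset V := S.filter fun u => u ≠ v ∧ ¬ G.Adj v u

/-- The number of ordered pairs of distinct nonadjacent vertices in `S`. -/
def miss (S : Finset V) : ℕ := ∑ v ∈ S, #(nonNbr G v S)

variable {G}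

theorem mem_nonNbr {v u : V} {S : Finset V} :
    u ∈ nonNbr G v S ↔ u ∈ S ∧ u ≠ v ∧ ¬ G.Adj v u := by simp [nonNbr]

theorem nonNbr_subset (v : V) (S : Finset V) : nonNbr G v S ⊆ S := filter_subset _ _

theorem nonNbr_mono {S T : Finset V} (h : S ⊆ T) (v : V) : nonNbr G v S ⊆ nonNbr G v T :=
  filter_subset_filter _ h

theorem card_nonNbr_union {S T : Finset V} (h : Disjoint S T) (v : V) :
    #(nonNbr G v (S ∪ T)) = #(nonNbr G v S) + #(nonNbr G v T) := by
  rw [nonNbr, filter_union, card_union_of_disjoint (disjoint_filter_filter h)]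
  rfl

theorem sum_card_nonNbr_comm (S T : Finset V) :
    ∑ v ∈ S, #(nonNbr G v T) = ∑ u ∈ T, #(nonNbr G u S) := by
  simp only [nonNbr, card_filter]
  rw [sum_comm]
  simp only [G.adj_comm, ne_comm]

/-- A non-edge between `S` and `T` gives two ordered pairs, one counted from each side. -/
theorem miss_union {S T : Finset V} (h : Disjoint S T) :
    miss G (S ∪ T) = miss G S + miss G T + 2 * ∑ v ∈ S, #(nonNbr G v T) := by
  have := sum_card_nonNbr_comm (G := G) S T
  simp only [miss, sum_union h, card_nonNbr_union h, sum_add_distrib]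
  omega

theorem miss_mono {S T : Finset V} (h : S ⊆ T) : miss G S ≤ miss G T :=
  (sum_le_sum fun v _ => card_le_card (nonNbr_mono h v)).trans
    (sum_le_sum_of_subset h)

theorem miss_of_indep {S : Finset V} (h : ∀ u ∈ S, ∀ v ∈ S, ¬ G.Adj u v) :
    miss G S = #S * (#S - 1) := by
  rw [miss, sum_congr rfl (g := fun _ => #S - 1), sum_const, smul_eq_mul]
  intro v hv
  rw [← card_erase_of_mem hv]
  congr 1
  ext u
  simp only [mem_nonNbr, mem_erase]
  exact ⟨fun hu => ⟨hu.2.1, hu.1⟩, fun hu => ⟨hu.2, hu.1, h v hv u hu.2⟩⟩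

/-- Every non-edge counts twice. -/
theorem two_mul_card_nonNbr_le_miss {S : Finset V} {v : V} (hv : v ∈ S) :
    2 * #(nonNbr G v S) ≤ miss G S := by
  have h := miss_union (G := G) (S := {v}) (T := S.erase v)
    (disjoint_singleton_left.2 (notMem_erase v S))
  have h2 : nonNbr G v (S.erase v) = nonNbr G v S := by
    ext u; simp only [mem_nonNbr, mem_erase]; tauto
  rw [← insert_eq, insert_erase hv, sum_singleton, h2] at h
  omega

/-- The vertices outside `C` are independent, and at most `k` edges are missing in `C`. -/
def IsSol (G : SimpleGraph V) [DecidableRel G.Adj] (C : Finset V) (k : ℕ) : Prop :=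
  (∀ u ∉ C, ∀ v ∉ C, ¬ G.Adj u v) ∧ miss G C ≤ 2 * k

theorem card_nonNbr_le {C : Finset V} {k : ℕ} (hC : IsSol G C k) {v : V}
    (hv : v ∈ C) : #(nonNbr G v C) ≤ k := by
  have := two_mul_card_nonNbr_le_miss (G := G) hv
  have := hC.2
  omega

/-- The graph of the non-edges inside `S`. -/
def missGraph (G : SimpleGraph V) (S : Finset V) : SimpleGraph V where
  Adj u v := u ∈ S ∧ v ∈ S ∧ u ≠ v ∧ ¬ G.Adj u v
  symm := ⟨fun u v h => ⟨h.2.1, h.1, h.2.2.1.symm, fun h' => h.2.2.2 h'.symm⟩⟩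

instance (S : Finset V) : DecidableRel (missGraph G S).Adj := fun u v =>
  inferInstanceAs (Decidable (u ∈ S ∧ v ∈ S ∧ u ≠ v ∧ ¬ G.Adj u v))

variable [Fintype V]

/-- Besides linking ordered pairs to edges, this shows that the count is even, so that halving it in
the new parameter is exact. -/
theorem miss_eq_two_mul (S : Finset V) : miss G S = 2 * #(missGraph G S).edgeFinset := by
  rw [← SimpleGraph.sum_degrees_eq_twice_card_edges, miss, ← sum_subset (subset_univ S)]
  · refine sum_congr rfl fun v hv => ?_
    rw [← SimpleGraph.card_neighborFinset_eq_degree]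
    congr 1
    ext u
    rw [SimpleGraph.mem_neighborFinset, mem_nonNbr]
    exact ⟨fun h => ⟨hv, h.1, h.2.1.symm, h.2.2⟩, fun h => ⟨h.2.1, h.2.2.1.symm, h.2.2.2⟩⟩
  · intro v _ hv
    rw [← SimpleGraph.card_neighborFinset_eq_degree, card_eq_zero, eq_empty_iff_forall_notMem]
    intro u hu
    rw [SimpleGraph.mem_neighborFinset] at hu
    exact hv hu.1

/-- Once the clique part `C` is fixed, the cheapest `F` consists of exactly the non-edges inside
`C`: edges added elsewhere only endanger the independence of the rest. -/
theorem exists_isSol_iff (k : ℕ) : (∃ C, IsSol G C k) ↔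
    ∃ F : Finset (Sym2 V), (∀ e ∈ F, ¬ e.IsDiag) ∧ #F ≤ k ∧
      IsSplitGraph (G ⊔ SimpleGraph.fromEdgeSet (F : Set (Sym2 V))) := by
  constructor
  · rintro ⟨C, h1, h2⟩
    rw [miss_eq_two_mul] at h2
    refine ⟨(missGraph G C).edgeFinset, fun e he => ?_, by omega, C, ?_, ?_⟩
    · exact SimpleGraph.not_isDiag_of_mem_edgeSet _ (SimpleGraph.mem_edgeFinset.1 he)
    · intro u hu v hv huv
      by_cases h : G.Adj u v
      · exact Or.inl h
      · right
        simp only [SimpleGraph.coe_edgeFinset, SimpleGraph.fromEdgeSet_edgeSet]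
        exact ⟨hu, hv, huv, h⟩
    · intro u hu v hv huv h
      rcases h with h | h
      · exact h1 u hu v hv h
      · simp only [SimpleGraph.coe_edgeFinset, SimpleGraph.fromEdgeSet_edgeSet] at h
        exact hu h.1
  · classical
    rintro ⟨F, h1, h2, K, h3, h4⟩
    refine ⟨univ.filter (· ∈ K), fun u hu v hv h => ?_, ?_⟩
    · simp only [mem_filter, mem_univ, true_and] at hu hv
      exact h4 hu hv h.ne (Or.inl h)
    · rw [miss_eq_two_mul]
      refine Nat.mul_le_mul_left 2 ((card_le_card fun e => ?_).trans h2)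
      induction e with | _ u v
      intro he
      rw [SimpleGraph.mem_edgeFinset, SimpleGraph.mem_edgeSet] at he
      obtain ⟨hu, hv, huv, h⟩ := he
      simp only [mem_filter, mem_univ, true_and] at hu hv
      have := h3 hu hv huv
      rcases this with hG | hF
      · exact absurd hG h
      · exact ((SimpleGraph.fromEdgeSet_adj _).1 hF).1

/-! ### Forced vertices -/

variable (G)

/-- The vertices whose neighbourhood misses more than `k` edges. -/
def denseForced (k : ℕ) : Finset V := univ.filter fun v => 2 * k < miss G (G.neighborFinset v)

/-- The vertices that have too many nonneighbours that belong to the clique if they do. -/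
def forcedOut (k : ℕ) : Finset V := univ.filter fun v =>
  k < #((nonNbr G v univ).filter fun u => k < #((nonNbr G v univ).filter (G.Adj u)))

/-- The vertices that are forced into the clique. -/
def forcedIn (k : ℕ) : Finset V :=
  univ.filter fun v => v ∈ denseForced G k ∨ ∃ u, G.Adj v u ∧ u ∈ forcedOut G k

/-- The vertices that are not forced. -/
def free (k : ℕ) : Finset V := univ.filter fun v => v ∉ forcedIn G k ∧ v ∉ forcedOut G k

/-- The free vertices with a free neighbour. -/
def linked (k : ℕ) : Finset V := (free G k).filter fun v => ∃ u, G.Adj v u ∧ u ∈ free G k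

/-- The number of vertices that are forced into the clique and not adjacent to `v`. -/
def weight (k : ℕ) (v : V) : ℕ := #(nonNbr G v (forcedIn G k))

/-- The vertices that are kept. -/
def core (k : ℕ) : Finset V :=
  (linked G k).filter fun v => 0 < weight G k v ∨ ∃ u, u ≠ v ∧ u ∈ linked G k ∧ ¬ G.Adj v u

variable {G} {k : ℕ} {C : Finset V}

/-- If `v` is outside `C`, then its whole neighbourhood is inside `C`, with too many missing edges.
-/
theorem mem_of_mem_denseForced (hC : IsSol G C k) {v : V} (hv : v ∈ denseForced G k) : v ∈ C := by
  by_contra hvC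
  simp only [denseForced, mem_filter, mem_univ, true_and] at hv
  refine absurd ((miss_mono fun u hu => ?_).trans hC.2) (not_le.2 hv)
  by_contra huC
  exact hC.1 v hvC u huC ((G.mem_neighborFinset v u).1 hu)

/-- Suppose `v` is in `C`; then it has at most `k` nonneighbours in `C`. A nonneighbour `u` outside
`C` has all its neighbours in `C`, hence at most `k` of them are nonneighbours of `v`. So the more
than `k` nonneighbours that are counted in `forcedOut` all lie in `C`, a contradiction. -/
theorem notMem_of_mem_forcedOut (hC : IsSol G C k) {v : V} (hv : v ∈ forcedOut G k) : v ∉ C := by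
  intro hvC
  simp only [forcedOut, mem_filter, mem_univ, true_and] at hv
  refine absurd ((card_le_card fun u hu => ?_).trans (card_nonNbr_le hC hvC)) (not_le.2 hv)
  rw [mem_filter, mem_nonNbr] at hu
  rw [mem_nonNbr]
  refine ⟨?_, hu.1.2⟩
  by_contra huC
  refine absurd ((card_le_card fun x hx => ?_).trans (card_nonNbr_le hC hvC)) (not_le.2 hu.2)
  rw [mem_filter, mem_nonNbr] at hx
  rw [mem_nonNbr]
  refine ⟨?_, hx.1.2⟩
  by_contra hxC
  exact hC.1 u huC x hxC hx.2

theorem mem_of_mem_forcedIn (hC : IsSol G C k) {v : V} (hv : v ∈ forcedIn G k) : v ∈ C := by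
  simp only [forcedIn, mem_filter, mem_univ, true_and] at hv
  rcases hv with hv | ⟨u, hvu, hu⟩
  · exact mem_of_mem_denseForced hC hv
  · by_contra hvC
    exact hC.1 v hvC u (notMem_of_mem_forcedOut hC hu) hvu

theorem miss_forcedIn_le (hC : IsSol G C k) : miss G (forcedIn G k) ≤ 2 * k :=
  (miss_mono fun _ => mem_of_mem_forcedIn hC).trans hC.2

theorem core_subset_linked : core G k ⊆ linked G k := filter_subset _ _

theorem linked_subset_free : linked G k ⊆ free G k := filter_subset _ _

theorem disjoint_forcedIn_free : Disjoint (forcedIn G k) (free G k) :=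
  disjoint_left.2 fun _ h1 h2 => (mem_filter.1 h2).2.1 h1

/-- `X` is the clique part of a solution for the kept vertices. -/
def IsCoreSol (G : SimpleGraph V) [DecidableRel G.Adj] (k : ℕ) (X : Finset V) : Prop :=
  X ⊆ core G k ∧ (∀ u ∈ core G k, u ∉ X → ∀ v ∈ core G k, v ∉ X → ¬ G.Adj u v) ∧
    miss G (forcedIn G k) + miss G X + 2 * ∑ x ∈ X, weight G k x ≤ 2 * k

theorem IsSol.isCoreSol (hC : IsSol G C k) : IsCoreSol G k (C ∩ core G k) := by
  refine ⟨inter_subset_right, fun u hu huX v hv hvX => hC.1 u (fun h => huX (mem_inter.2 ⟨h, hu⟩))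
    v (fun h => hvX (mem_inter.2 ⟨h, hv⟩)), ?_⟩
  have hd : Disjoint (C ∩ core G k) (forcedIn G k) :=
    (disjoint_forcedIn_free.mono_right (inter_subset_right.trans
      (core_subset_linked.trans linked_subset_free))).symm
  have h1 := miss_union (G := G) hd
  have h2 := miss_mono (G := G) (union_subset (inter_subset_left (s₁ := C) (s₂ := core G k))
    fun v hv => mem_of_mem_forcedIn hC hv)
  have h3 := hC.2
  simp only [weight]
  omega

theorem nonNbr_eq_empty_of_notMem_core {v : V} (hv : v ∈ linked G k) (hv' : v ∉ core G k) :
    nonNbr G v (forcedIn G k ∪ linked G k) = ∅ := by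
  rw [core, mem_filter] at hv'
  simp only [hv, true_and, not_or, not_exists, weight, not_lt, Nat.le_zero,
    card_eq_zero, not_and, not_not] at hv'
  rw [eq_empty_iff_forall_notMem]
  intro u hu
  rw [mem_nonNbr, mem_union] at hu
  rcases hu.1 with h | h
  · exact absurd (mem_nonNbr.2 ⟨h, hu.2⟩) (hv'.1 ▸ notMem_empty u)
  · exact hu.2.2 (hv'.2 u hu.2.1 h)

/-- The clique part is `X` with the forced-in vertices and the linked vertices outside the core. The
last ones are adjacent to everything else in it, so they cost nothing. An edge that avoids the
forced-in vertices has two free, hence linked, ends, so only edges inside the core have to be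
covered by `X`. -/
theorem IsCoreSol.exists_isSol {X : Finset V} (hX : IsCoreSol G k X) : ∃ C, IsSol G C k := by
  obtain ⟨hXc, hind, hmiss⟩ := hX
  have hfree : ∀ u v, G.Adj u v → u ∉ forcedIn G k → v ∉ forcedIn G k → v ∉ forcedOut G k := by
    intro u v huv hu hv h
    exact hu (by simp only [forcedIn, mem_filter, mem_univ, true_and]; exact Or.inr ⟨v, huv, h⟩)
  have hlinked : ∀ u v, G.Adj u v → u ∉ forcedIn G k → v ∉ forcedIn G k → u ∈ linked G k := by
    intro u v huv hu hv
    have h1 := hfree u v huv hu hv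
    have h2 := hfree v u huv.symm hv hu
    simp only [linked, free, mem_filter, mem_univ, true_and]
    exact ⟨⟨hu, h2⟩, v, huv, hv, h1⟩
  have hXd : Disjoint X (forcedIn G k) :=
    (disjoint_forcedIn_free.mono_right (hXc.trans (core_subset_linked.trans
      linked_subset_free))).symm
  have hZd : Disjoint (linked G k \ core G k) (X ∪ forcedIn G k) := by
    rw [disjoint_left]
    intro v hv hv'
    rw [mem_sdiff] at hv
    rcases mem_union.1 hv' with h | h
    · exact hv.2 (hXc h)
    · exact disjoint_left.1 disjoint_forcedIn_free h (linked_subset_free hv.1)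
  have hZ : ∀ v ∈ linked G k \ core G k, ∀ S ⊆ forcedIn G k ∪ linked G k,
      #(nonNbr G v S) = 0 := by
    intro v hv S hS
    rw [mem_sdiff] at hv
    rw [card_eq_zero, ← subset_empty, ← nonNbr_eq_empty_of_notMem_core hv.1 hv.2]
    exact nonNbr_mono hS v
  refine ⟨(linked G k \ core G k) ∪ (X ∪ forcedIn G k), fun u hu v hv huv => ?_, ?_⟩
  · simp only [mem_union, mem_sdiff, not_or, not_and, not_not] at hu hv
    have hul := hlinked u v huv hu.2.2 hv.2.2
    have hvl := hlinked v u huv.symm hv.2.2 hu.2.2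
    exact hind u (hu.1 hul) hu.2.1 v (hv.1 hvl) hv.2.1 huv
  · rw [miss_union hZd, miss_union hXd, miss, sum_eq_zero fun v hv =>
      hZ v hv _ (sdiff_subset.trans subset_union_right), sum_eq_zero fun v hv => hZ v hv _
      (union_subset (hXc.trans (core_subset_linked.trans subset_union_right)) subset_union_left)]
    simp only [weight] at hmiss
    omega

/-! ### The gadget -/

/-- `H` consists of a copy `P` of the kept vertices, a clique `Q`, and an independent set `R` of
`k + 2` vertices that is complete to `Q`; the weight of a kept vertex is the number of its
nonneighbours in `Q`. -/
structure IsGadget {W : Type*} [DecidableEq W] (H : SimpleGraph W) [DecidableRel H.Adj]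
    (G : SimpleGraph V) [DecidableRel G.Adj] (k : ℕ) (P Q R : Finset W) (g : V → W) : Prop where
  cover : ∀ w, w ∈ P ∨ w ∈ Q ∨ w ∈ R
  disj : Disjoint P Q
  image : (core G k).image g = P
  inj : Set.InjOn g (core G k)
  adj_iff : ∀ u ∈ core G k, ∀ v ∈ core G k, (H.Adj (g u) (g v) ↔ G.Adj u v)
  clique : ∀ i ∈ Q, ∀ j ∈ Q, i ≠ j → H.Adj i j
  complete : ∀ i ∈ Q, ∀ j ∈ R, H.Adj i j
  indep : ∀ i ∈ R, ∀ j ∈ R, ¬ H.Adj i j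
  none : ∀ i ∈ P, ∀ j ∈ R, ¬ H.Adj i j
  card_nonNbr : ∀ u ∈ core G k, #(nonNbr H (g u) Q) = min (weight G k u) (k + 1)
  card_R : #R = k + 2

theorem IsGadget.miss_eq {W : Type*} [DecidableEq W] {H : SimpleGraph W}
    [DecidableRel H.Adj] {P Q R : Finset W} {g : V → W} (h : IsGadget H G k P Q R g)
    {S : Finset V} (hS : S ⊆ core G k) : miss H (S.image g) = miss G S := by
  have hinj : Set.InjOn g S := h.inj.mono (by exact_mod_cast hS)
  rw [miss, sum_image hinj, miss]
  refine sum_congr rfl fun v hv => ?_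
  rw [← card_image_of_injOn (hinj.mono (s₁ := (nonNbr G v S : Set V)) (by
    exact_mod_cast nonNbr_subset v S))]
  congr 1
  ext y
  simp only [mem_nonNbr, mem_image]
  constructor
  · rintro ⟨⟨u, hu, rfl⟩, h1, h2⟩
    exact ⟨u, ⟨hu, fun h' => h1 (by rw [h']), fun h' => h2 ((h.adj_iff v (hS hv) u (hS hu)).2 h')⟩,
      rfl⟩
  · rintro ⟨u, ⟨hu, h1, h2⟩, rfl⟩
    exact ⟨⟨u, hu, rfl⟩, fun h' => h1 (hinj hu hv h'),
      fun h' => h2 ((h.adj_iff v (hS hv) u (hS hu)).1 h')⟩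

/-- A solution that omits a vertex of `Q` must contain all of `R`, which misses too many edges. So
`Q` plays the role of the forced-in vertices, while `R` can always be left outside. -/
theorem IsGadget.exists_isSol_iff {W : Type*} [DecidableEq W] {H : SimpleGraph W}
    [DecidableRel H.Adj] {P Q R : Finset W} {g : V → W} (h : IsGadget H G k P Q R g) {k' : ℕ}
    (hk : 2 * k' + miss G (forcedIn G k) = 2 * k) :
    (∃ D, IsSol H D k') ↔ ∃ X, IsCoreSol G k X := by
  have hQ : miss H Q = 0 := by
    refine sum_eq_zero fun v hv => ?_
    rw [card_eq_zero, eq_empty_iff_forall_notMem]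
    intro u hu
    rw [mem_nonNbr] at hu
    exact hu.2.2 (h.clique v hv u hu.1 hu.2.1.symm)
  have hmem : ∀ u ∈ core G k, g u ∈ P := fun u hu => h.image ▸ mem_image_of_mem g hu
  have hdisj : ∀ S ⊆ core G k, Disjoint (S.image g) Q := fun S hS =>
    h.disj.mono_left (h.image ▸ image_subset_image hS)
  have hinj : ∀ S ⊆ core G k, Set.InjOn g S := fun S hS => h.inj.mono (by exact_mod_cast hS)
  constructor
  · rintro ⟨D, hD⟩
    have hQD : Q ⊆ D := by
      intro q hq
      by_contra hqD
      have hR : R ⊆ D := fun r hr => by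
        by_contra hrD
        exact hD.1 q hqD r hrD (h.complete q hq r hr)
      have h1 := (miss_mono hR).trans hD.2
      rw [miss_of_indep h.indep, h.card_R] at h1
      have h2 : (k + 2) * (k + 2 - 1) = (k + 2) * k + (k + 2) := by
        rw [show k + 2 - 1 = k + 1 by omega]; ring
      nlinarith
    have hX : (core G k).filter (fun u => g u ∈ D) ⊆ core G k := filter_subset _ _
    have hXD : ((core G k).filter fun u => g u ∈ D).image g ⊆ D := fun i hi => by
      obtain ⟨u, hu, rfl⟩ := mem_image.1 hi
      exact (mem_filter.1 hu).2
    have h1 := (miss_mono (union_subset hXD hQD)).trans hD.2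
    rw [miss_union (hdisj _ hX), hQ, h.miss_eq hX, sum_image (hinj _ hX)] at h1
    refine ⟨(core G k).filter fun u => g u ∈ D, hX, ?_, ?_⟩
    · intro u hu huX v hv hvX huv
      exact hD.1 (g u) (fun h' => huX (mem_filter.2 ⟨hu, h'⟩)) (g v)
        (fun h' => hvX (mem_filter.2 ⟨hv, h'⟩)) ((h.adj_iff u hu v hv).2 huv)
    -- A vertex of the solution has at most `k' ≤ k` nonneighbours in `Q ⊆ D`, so the truncation of
    -- its weight at `k + 1` is not active.
    · have h2 : ∑ u ∈ (core G k).filter (fun u => g u ∈ D), weight G k u =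
          ∑ u ∈ (core G k).filter (fun u => g u ∈ D), #(nonNbr H (g u) Q) := by
        refine sum_congr rfl fun u hu => ?_
        have h3 := h.card_nonNbr u (mem_filter.1 hu).1
        have h4 := (card_le_card (nonNbr_mono hQD (g u))).trans
          (card_nonNbr_le hD (mem_filter.1 hu).2)
        omega
      omega
  · rintro ⟨X, hXc, hind, hmiss⟩
    refine ⟨X.image g ∪ Q, fun u hu v hv huv => ?_, ?_⟩
    · simp only [mem_union, not_or] at hu hv
      have hP : ∀ i ∈ P, i ∉ X.image g → ∃ a ∈ core G k, a ∉ X ∧ g a = i := by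
        intro i hi hiX
        rw [← h.image, mem_image] at hi
        obtain ⟨a, ha, rfl⟩ := hi
        exact ⟨a, ha, fun h' => hiX (mem_image_of_mem g h'), rfl⟩
      rcases h.cover u with hu' | hu' | hu'
      · rcases h.cover v with hv' | hv' | hv'
        · obtain ⟨a, ha, haX, rfl⟩ := hP u hu' hu.1
          obtain ⟨b, hb, hbX, rfl⟩ := hP v hv' hv.1
          exact hind a ha haX b hb hbX ((h.adj_iff a ha b hb).1 huv)
        · exact hv.2 hv'
        · exact h.none u hu' v hv' huv
      · exact hu.2 hu'
      · rcases h.cover v with hv' | hv' | hv'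
        · exact h.none v hv' u hu' huv.symm
        · exact hv.2 hv'
        · exact h.indep u hu' v hv' huv
    · rw [miss_union (hdisj _ hXc), hQ, h.miss_eq hXc, sum_image (hinj _ hXc)]
      have h2 : ∑ u ∈ X, #(nonNbr H (g u) Q) ≤ ∑ x ∈ X, weight G k x :=
        sum_le_sum fun u hu => by
          rw [h.card_nonNbr u (hXc hu)]
          exact min_le_left _ _
      omega

end Abstract

end SplitKernel

/-! ### The number of kept vertices -/

namespace SplitKernel

open Finset

section Bound

variable {V : Type*} [DecidableEq V] {G : SimpleGraph V} [DecidableRel G.Adj]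
  {k : ℕ} {C : Finset V}

theorem le_succ_of_mul_pred_le {q k : ℕ} (h : q * (q - 1) ≤ 2 * k) : q ≤ k + 1 := by
  by_contra! hq
  have : (k + 2) * (k + 1) ≤ q * (q - 1) := Nat.mul_le_mul (by omega) (by omega)
  nlinarith

theorem card_touched_le (hC : IsSol G C k) : #(C.filter fun v => nonNbr G v C ≠ ∅) ≤ 2 * k := by
  refine le_trans ?_ hC.2
  rw [miss, card_eq_sum_ones, sum_filter]
  refine sum_le_sum fun v _ => ?_
  split_ifs with h
  · exact card_pos.2 (nonempty_iff_ne_empty.2 h)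
  · exact Nat.zero_le _

theorem card_filter_adj_add {b : V} {S : Finset V} (hb : b ∉ S) :
    #(S.filter (G.Adj b)) + #(nonNbr G b S) = #S := by
  have : nonNbr G b S = S.filter fun u => ¬ G.Adj b u :=
    filter_congr fun u hu => ⟨fun h => h.2, fun h => ⟨fun h' => hb (h' ▸ hu), h⟩⟩
  rw [this, card_filter_add_card_filter_not]

theorem sum_sum_filter_adj {V : Type*} {G : SimpleGraph V} [DecidableRel G.Adj]
    (S B : Finset V) (D : V → ℕ) :
    ∑ a ∈ S, ∑ b ∈ B.filter (G.Adj a), D b = ∑ b ∈ B, #(S.filter (G.Adj b)) * D b := by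
  simp only [sum_filter]
  rw [sum_comm]
  refine sum_congr rfl fun b _ => ?_
  rw [← sum_filter, sum_const, smul_eq_mul]
  simp only [G.adj_comm]

theorem card_eq_card_complete_add (B S : Finset V) : #B =
    #(B.filter fun b => nonNbr G b S = ∅) + #(B.filter fun b => ¬ nonNbr G b S = ∅) :=
  (card_filter_add_card_filter_not _).symm

variable [Fintype V]

/-- An independent set `Y` in the neighbourhood of a free vertex misses few edges to a set `Z` in
the neighbourhood. -/
theorem miss_neighbors_le {a : V} (ha : a ∈ free G k) {Y Z : Finset V} (hY : ∀ v ∈ Y, G.Adj a v)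
    (hZ : ∀ v ∈ Z, G.Adj a v) (hd : Disjoint Y Z) (hind : ∀ u ∈ Y, ∀ v ∈ Y, ¬ G.Adj u v) :
    #Y * (#Y - 1) + 2 * ∑ b ∈ Y, #(nonNbr G b Z) ≤ 2 * k := by
  have h1 : miss G (G.neighborFinset a) ≤ 2 * k := by
    by_contra! h
    refine (mem_filter.1 ha).2.1 (mem_filter.2 ⟨mem_univ _, Or.inl ?_⟩)
    exact mem_filter.2 ⟨mem_univ _, h⟩
  have h2 : miss G (Y ∪ Z) ≤ miss G (G.neighborFinset a) := miss_mono fun v hv => by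
    rw [SimpleGraph.mem_neighborFinset]
    exact (mem_union.1 hv).elim (hY v) (hZ v)
  rw [miss_union hd, miss_of_indep hind] at h2
  omega

/-- A vertex that is not forced out has few untouched nonneighbours in the clique. -/
theorem card_nonNbr_untouched_le {b : V} (hb : b ∉ forcedOut G k) {S : Finset V} (hS : S ⊆ C)
    (hS' : ∀ v ∈ S, nonNbr G v C = ∅) : #(nonNbr G b S) ≤ k + 1 := by
  by_contra! h
  refine hb (mem_filter.2 ⟨mem_univ _, ?_⟩)
  refine lt_of_lt_of_le (by omega : k < #(nonNbr G b S)) (card_le_card fun u hu => ?_)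
  rw [mem_filter]
  refine ⟨nonNbr_mono (subset_univ S) b hu, ?_⟩
  -- There are at least `k + 2` nonneighbours of `b` in `S`, and `u`, being untouched, is adjacent
  -- to all the others: at least `k + 1`.
  have h1 : k < #((nonNbr G b S).erase u) := by rw [card_erase_of_mem hu]; omega
  refine lt_of_lt_of_le h1 (card_le_card fun x hx => ?_)
  rw [mem_erase] at hx
  rw [mem_filter]
  refine ⟨nonNbr_mono (subset_univ S) b hx.2, ?_⟩
  by_contra hux
  have : x ∈ nonNbr G u C := mem_nonNbr.2 ⟨hS (mem_nonNbr.1 hx.2).1, hx.1, hux⟩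
  rw [hS' u (mem_nonNbr.1 hu).1] at this
  exact notMem_empty _ this

theorem notMem_forcedOut_of_mem_linked {b : V} (hb : b ∈ linked G k) : b ∉ forcedOut G k :=
  (mem_filter.1 (linked_subset_free hb)).2.2

/-- The setting of the count: `A` is the clique part and `B` the independent part of the free
vertices, and `A₁` is the part of `A` that is not touched by missing edges. -/
structure Count (G : SimpleGraph V) [DecidableRel G.Adj] (k : ℕ) (C A A₁ B : Finset V) : Prop where
  sol : IsSol G C k
  hA : A = free G k ∩ C
  hA₁ : A₁ = A.filter fun v => nonNbr G v C = ∅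
  hB : B = linked G k \ C

namespace Count

variable {A A₁ B : Finset V}

theorem mem_A (h : Count G k C A A₁ B)
    {a : V} : a ∈ A ↔ a ∈ free G k ∧ a ∈ C := by rw [h.hA, mem_inter]

theorem mem_A₁ (h : Count G k C A A₁ B)
    {a : V} : a ∈ A₁ ↔ a ∈ A ∧ nonNbr G a C = ∅ := by rw [h.hA₁, mem_filter]

theorem mem_B (h : Count G k C A A₁ B)
    {b : V} : b ∈ B ↔ b ∈ linked G k ∧ b ∉ C := by rw [h.hB, mem_sdiff]

theorem subset_A (h : Count G k C A A₁ B) : A₁ ⊆ A := fun _ ha => (h.mem_A₁.1 ha).1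

theorem notMem_A (h : Count G k C A A₁ B)
    {b : V} (hb : b ∈ B) : b ∉ A := fun hbA => (h.mem_B.1 hb).2 (h.mem_A.1 hbA).2

theorem indep (h : Count G k C A A₁ B) {u v : V} (hu : u ∈ B) (hv : v ∈ B) : ¬ G.Adj u v :=
  h.sol.1 u (h.mem_B.1 hu).2 v (h.mem_B.1 hv).2

theorem exists_adj (h : Count G k C A A₁ B) {b : V} (hb : b ∈ B) : ∃ a ∈ A, G.Adj a b := by
  obtain ⟨hb1, hb2⟩ := h.mem_B.1 hb
  obtain ⟨u, hbu, hu⟩ := (mem_filter.1 hb1).2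
  refine ⟨u, h.mem_A.2 ⟨hu, ?_⟩, hbu.symm⟩
  by_contra huC
  exact h.sol.1 b hb2 u huC hbu

theorem card_core_le_add (h : Count G k C A A₁ B) : #(core G k) ≤ #A + #B := by
  refine le_trans (card_le_card fun v hv => ?_) (card_union_le A B)
  have hv' := core_subset_linked hv
  rw [mem_union, h.mem_A, h.mem_B]
  by_cases hvC : v ∈ C
  · exact Or.inl ⟨linked_subset_free hv', hvC⟩
  · exact Or.inr ⟨hv', hvC⟩

/-- An untouched core vertex of `C` is adjacent to everything else in `C`, in particular to the
forced-in vertices. So the nonneighbour that put it into the core is linked and outside `C`, that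
is, in `B`. -/
theorem card_core_le_touched (h : Count G k C A A₁ B) :
    #(core G k) ≤ 2 * k + #(A₁.filter fun a => ∃ b ∈ B, ¬ G.Adj a b) + #B := by
  refine le_trans (card_le_card (t := ((C.filter fun v => nonNbr G v C ≠ ∅) ∪
    A₁.filter fun a => ∃ b ∈ B, ¬ G.Adj a b) ∪ B) fun v hv => ?_) ((card_union_le _ _).trans
    (Nat.add_le_add_right ((card_union_le _ _).trans
    (Nat.add_le_add_right (card_touched_le h.sol) _)) _))
  have hv' := core_subset_linked hv
  rw [mem_union, mem_union, mem_filter, mem_filter, h.mem_B, h.mem_A₁, h.mem_A]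
  by_cases hvC : v ∈ C
  · left
    by_cases ht : nonNbr G v C = ∅
    · right
      refine ⟨⟨⟨linked_subset_free hv', hvC⟩, ht⟩, ?_⟩
      have hC : ∀ u ∈ C, u ≠ v → G.Adj v u := fun u hu huv => by
        by_contra hadj
        exact notMem_empty u (ht ▸ mem_nonNbr.2 ⟨hu, huv, hadj⟩)
      rcases (mem_filter.1 hv).2 with hw | ⟨u, huv, hu, hvu⟩
      · obtain ⟨u, hu⟩ := card_pos.1 hw
        rw [mem_nonNbr] at hu
        exact absurd (hC u (mem_of_mem_forcedIn h.sol hu.1) hu.2.1) hu.2.2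
      · exact ⟨u, h.mem_B.2 ⟨hu, fun huC => hvu (hC u huC huv)⟩, hvu⟩
    · exact Or.inl ⟨hvC, ht⟩
  · exact Or.inr ⟨hv', hvC⟩

/-! ### Double counting of the non-edges between `A` and `B` -/

theorem card_adj_mul_pred_le (h : Count G k C A A₁ B) {a : V} (ha : a ∈ A) :
    #(B.filter (G.Adj a)) * (#(B.filter (G.Adj a)) - 1) ≤ 2 * k := by
  have := miss_neighbors_le (h.mem_A.1 ha).1 (Y := B.filter (G.Adj a)) (Z := ∅)
    (fun v hv => (mem_filter.1 hv).2) (by simp) (disjoint_empty_right _)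
    (fun u hu v hv => h.indep (mem_filter.1 hu).1 (mem_filter.1 hv).1)
  omega

theorem sum_card_nonNbr_adj_le (h : Count G k C A A₁ B) {a : V} (ha : a ∈ A) :
    ∑ b ∈ B.filter (G.Adj a), #(nonNbr G b (A.filter (G.Adj a))) ≤ k := by
  have := miss_neighbors_le (h.mem_A.1 ha).1 (Y := B.filter (G.Adj a)) (Z := A.filter (G.Adj a))
    (fun v hv => (mem_filter.1 hv).2) (fun v hv => (mem_filter.1 hv).2)
    (disjoint_left.2 fun v hv hv' => h.notMem_A (mem_filter.1 hv).1 (mem_filter.1 hv').1)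
    (fun u hu v hv => h.indep (mem_filter.1 hu).1 (mem_filter.1 hv).1)
  omega

theorem card_complete_le (h : Count G k C A A₁ B) {S : Finset V} {a : V} (ha : a ∈ S) (hS : S ⊆ A) :
    #(B.filter fun b => nonNbr G b S = ∅) ≤ #(B.filter (G.Adj a)) := by
  refine card_le_card fun b hb => ?_
  rw [mem_filter] at hb ⊢
  refine ⟨hb.1, ?_⟩
  by_contra hab
  exact notMem_empty a (hb.2 ▸ mem_nonNbr.2
    ⟨ha, fun hab' => h.notMem_A hb.1 (hab' ▸ hS ha), fun h' => hab h'.symm⟩)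

theorem card_filter_nonadj_le (h : Count G k C A A₁ B) :
    #(A₁.filter fun a => ∃ b ∈ B, ¬ G.Adj a b) ≤ ∑ b ∈ B, #(nonNbr G b A₁) := by
  refine le_trans (card_le_card fun a ha => ?_) card_biUnion_le
  rw [mem_filter] at ha
  obtain ⟨ha, b, hb, hab⟩ := ha
  exact mem_biUnion.2 ⟨b, hb, mem_nonNbr.2 ⟨ha, fun hab' => h.notMem_A hb (hab' ▸ h.subset_A ha),
    fun h' => hab h'.symm⟩⟩

/-- An untouched `a` is adjacent to all other vertices of `A`. So for each neighbour `b` of `a`, the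
nonneighbours of `b` in `A₁` lie in the neighbourhood of `a`, which misses at most `k` edges.
Summing over `a` and exchanging the sums gives the claim. -/
theorem sum_untouched_le (h : Count G k C A A₁ B) :
    ∑ b ∈ B, #(A₁.filter (G.Adj b)) * #(nonNbr G b A₁) ≤ #A₁ * k := by
  rw [← sum_sum_filter_adj, ← smul_eq_mul]
  refine sum_le_card_nsmul _ _ _ fun a ha => ?_
  refine le_trans (sum_le_sum fun b hb => card_le_card fun u hu => ?_)
    (h.sum_card_nonNbr_adj_le (h.subset_A ha))
  rw [mem_nonNbr] at hu ⊢
  refine ⟨mem_filter.2 ⟨h.subset_A hu.1, ?_⟩, hu.2⟩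
  by_contra hau
  have hua : u ≠ a := fun hua => hu.2.2 (hua ▸ (mem_filter.1 hb).2.symm)
  exact notMem_empty u ((h.mem_A₁.1 ha).2 ▸
    mem_nonNbr.2 ⟨(h.mem_A.1 (h.subset_A hu.1)).2, hua, hau⟩)

/-- The same count over all of `A`. Nonneighbours of `b` that are also nonneighbours of `a` now
escape the neighbourhood of `a`; they contribute at most `p` times the number of ordered non-edges
inside `A`, which is at most `2 * k`. -/
theorem sum_all_le (h : Count G k C A A₁ B) {p : ℕ} (hp : ∀ a ∈ A, #(B.filter (G.Adj a)) ≤ p) :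
    ∑ b ∈ B, #(A.filter (G.Adj b)) * #(nonNbr G b A) ≤ k * (#A + 2 * p) := by
  rw [← sum_sum_filter_adj]
  have h1 : ∀ a ∈ A, ∑ b ∈ B.filter (G.Adj a), #(nonNbr G b A) ≤ k + p * #(nonNbr G a A) := by
    intro a ha
    have h2 : ∀ b ∈ B.filter (G.Adj a), #(nonNbr G b A) ≤
        #(nonNbr G b (A.filter (G.Adj a))) + #(nonNbr G a A) := by
      intro b hb
      refine le_trans (card_le_card fun u hu => ?_) (card_union_le _ _)
      rw [mem_union, mem_nonNbr, mem_nonNbr, mem_filter]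
      rw [mem_nonNbr] at hu
      have hua : u ≠ a := fun hua => hu.2.2 (hua ▸ (mem_filter.1 hb).2.symm)
      tauto
    have h3 := sum_le_sum h2
    rw [sum_add_distrib, sum_const, smul_eq_mul] at h3
    have h4 := h.sum_card_nonNbr_adj_le ha
    have h5 := Nat.mul_le_mul_right #(nonNbr G a A) (hp a ha)
    omega
  have h6 := sum_le_sum h1
  rw [sum_add_distrib, sum_const, smul_eq_mul, ← mul_sum] at h6
  have h7 : ∑ a ∈ A, #(nonNbr G a A) ≤ 2 * k :=
    (miss_mono (G := G) fun a ha => (h.mem_A.1 ha).2).trans h.sol.2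
  have h8 := Nat.mul_le_mul_left p h7
  nlinarith

/-- Each `b` has at most `k + 1` nonneighbours in `A₁`, hence is adjacent to at least half of it,
and `sum_untouched_le` leaves at most `2 * k` non-edges between `A₁` and `B`. They bound both the
vertices of `A₁` with a nonneighbour in `B` and the vertices of `B` that are not complete to `A₁`;
at most `k + 1` are complete. With the `2 * k` touched vertices the total is at most `7 * k + 1`. -/
theorem card_core_le_of_large (h : Count G k C A A₁ B)
    (hm : 2 * k + 2 ≤ #A₁) : #(core G k) ≤ 9 * k + 1 := by
  have h1 := h.sum_untouched_le
  have h2 : ∑ b ∈ B, #A₁ * #(nonNbr G b A₁) ≤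
      2 * ∑ b ∈ B, #(A₁.filter (G.Adj b)) * #(nonNbr G b A₁) := by
    rw [mul_sum]
    refine sum_le_sum fun b hb => ?_
    rw [← mul_assoc]
    refine Nat.mul_le_mul_right _ ?_
    have h3 := card_filter_adj_add (G := G) (b := b) (S := A₁)
      fun hb' => h.notMem_A hb (h.subset_A hb')
    have h4 := card_nonNbr_untouched_le
      (notMem_forcedOut_of_mem_linked (h.mem_B.1 hb).1) (S := A₁)
      (fun a ha => (h.mem_A.1 (h.subset_A ha)).2) (fun a ha => (h.mem_A₁.1 ha).2)
    omega
  rw [← mul_sum] at h2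
  have h3 : ∑ b ∈ B, #(nonNbr G b A₁) ≤ 2 * k := by
    refine Nat.le_of_mul_le_mul_left (c := #A₁) ?_ (by omega)
    nlinarith
  obtain ⟨a, ha⟩ := card_pos.1 (by omega : 0 < #A₁)
  have h4 := h.card_complete_le ha h.subset_A
  have h5 := le_succ_of_mul_pred_le (h.card_adj_mul_pred_le (h.subset_A ha))
  have h6 : #(B.filter fun b => ¬ nonNbr G b A₁ = ∅) ≤ ∑ b ∈ B, #(nonNbr G b A₁) := by
    rw [card_filter]
    refine sum_le_sum fun b _ => ?_
    split_ifs with hb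
    · exact Nat.zero_le _
    · exact card_pos.2 (nonempty_iff_ne_empty.2 hb)
  have h7 := card_eq_card_complete_add (G := G) B A₁
  have h8 := h.card_filter_nonadj_le
  have h9 := h.card_core_le_touched
  omega

theorem card_A_le (h : Count G k C A A₁ B) : #A ≤ #A₁ + 2 * k := by
  refine le_trans (card_le_card (t := A₁ ∪ C.filter fun v => nonNbr G v C ≠ ∅) fun a ha => ?_)
    ((card_union_le _ _).trans (Nat.add_le_add_left (card_touched_le h.sol) _))
  rw [mem_union, h.mem_A₁, mem_filter]
  by_cases ht : nonNbr G a C = ∅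
  · exact Or.inl ⟨ha, ht⟩
  · exact Or.inr ⟨(h.mem_A.1 ha).2, ht⟩

theorem card_B_le_mul (h : Count G k C A A₁ B)
    {p : ℕ} (hp : ∀ a ∈ A, #(B.filter (G.Adj a)) ≤ p) : #B ≤ #A * p := by
  refine le_trans (card_le_card fun b hb => ?_) (card_biUnion_le_card_mul A _ p hp)
  obtain ⟨a, ha, hab⟩ := h.exists_adj hb
  exact mem_biUnion.2 ⟨a, ha, mem_filter.2 ⟨hb, hab⟩⟩

/-- A vertex of `B` that is not complete to `A` has both a neighbour and a nonneighbour in `A`, so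
it contributes at least `#A - 1` to the sum in `sum_all_le`. At most `p` vertices are complete to
`A`. -/
theorem card_B_le (h : Count G k C A A₁ B)
    {p : ℕ} (hp : ∀ a ∈ A, #(B.filter (G.Adj a)) ≤ p) (hp' : p * (p - 1) ≤ 2 * k)
    (hp1 : 1 ≤ p) (hM : p + 1 ≤ #A) (hk : 1 ≤ k) : #B ≤ 5 * k := by
  have h1 := h.sum_all_le hp
  have h2 : #(B.filter fun b => ¬ nonNbr G b A = ∅) * (#A - 1) ≤
      ∑ b ∈ B, #(A.filter (G.Adj b)) * #(nonNbr G b A) := by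
    rw [← smul_eq_mul, ← sum_const, sum_filter]
    refine sum_le_sum fun b hb => ?_
    split_ifs with hbA
    · exact Nat.zero_le _
    · have h3 := card_filter_adj_add (G := G) (h.notMem_A hb)
      have h4 := card_pos.2 (nonempty_iff_ne_empty.2 hbA)
      have h5 : 0 < #(A.filter (G.Adj b)) := by
        obtain ⟨a, ha, hab⟩ := h.exists_adj hb
        exact card_pos.2 ⟨a, mem_filter.2 ⟨ha, hab.symm⟩⟩
      -- Two positive integers with sum `#A` have product at least `#A - 1`.
      have h6 : #A - 1 = (#(A.filter (G.Adj b)) - 1) + (#(nonNbr G b A) - 1) + 1 := by omega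
      obtain ⟨x, hx⟩ := Nat.exists_eq_add_of_lt h4
      obtain ⟨y, hy⟩ := Nat.exists_eq_add_of_lt h5
      rw [h6, hx, hy]
      simp only [zero_add, Nat.add_sub_cancel]
      nlinarith [Nat.zero_le (x * y)]
  obtain ⟨a, ha⟩ := card_pos.1 (by omega : 0 < #A)
  have h3 := (h.card_complete_le ha subset_rfl).trans (hp a ha)
  have h4 := card_eq_card_complete_add (G := G) B A
  have h5 := le_succ_of_mul_pred_le hp'
  set x := #(B.filter fun b => ¬ nonNbr G b A = ∅)
  obtain ⟨M, hM'⟩ : ∃ M, #A = M + 1 := ⟨#A - 1, by omega⟩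
  rw [hM'] at h1 h2 hM
  rw [Nat.add_sub_cancel] at h2
  have h6 := h2.trans h1
  rcases Nat.lt_or_ge p 2 with hp2 | hp2
  · obtain rfl : p = 1 := by omega
    have : x ≤ 4 * k := by
      refine Nat.le_of_mul_le_mul_right (c := M) ?_ (by omega)
      nlinarith
    omega
  · have : 2 * x ≤ 7 * k := by
      refine Nat.le_of_mul_le_mul_right (c := M) ?_ (by omega)
      -- This uses `p ≤ M` and `2 ≤ M`.
      have h7 : k * (2 * (M + 1 + 2 * p)) ≤ k * (7 * M) := Nat.mul_le_mul_left k (by omega)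
      nlinarith
    omega

theorem card_core_le_of_small (h : Count G k C A A₁ B)
    (hm : #A₁ ≤ 2 * k + 1) : #(core G k) ≤ 9 * k + 1 := by
  have h1 := h.card_core_le_touched
  have h2 := card_filter_le A₁ fun a => ∃ b ∈ B, ¬ G.Adj a b
  have h3 := h.card_A_le
  rcases B.eq_empty_or_nonempty with hB | ⟨b, hb⟩
  · simp only [hB, notMem_empty, false_and, exists_false, filter_false, card_empty] at h1
    omega
  obtain ⟨a₀, ha₀, hab⟩ := h.exists_adj hb
  obtain ⟨a, ha, hmax⟩ := exists_max_image A (fun a => #(B.filter (G.Adj a))) ⟨a₀, ha₀⟩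
  have hp' := h.card_adj_mul_pred_le ha
  have hp1 : 1 ≤ #(B.filter (G.Adj a)) :=
    le_trans (card_pos.2 ⟨b, mem_filter.2 ⟨hb, hab⟩⟩) (hmax a₀ ha₀)
  have hp2 := le_succ_of_mul_pred_le hp'
  have h4 := h.card_B_le_mul hmax
  set p := #(B.filter (G.Adj a))
  rcases Nat.eq_zero_or_pos k with rfl | hk
  -- For `k = 0` the bound `5 * k` on `#B` can fail; but `A` has at most one element, to which all
  -- of `B` is adjacent.
  · have hA : #A ≤ 1 := by omega
    have hA' : A₁.filter (fun a => ∃ b ∈ B, ¬ G.Adj a b) = ∅ := by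
      rw [filter_eq_empty_iff]
      rintro a ha ⟨b, hb, hab⟩
      obtain ⟨a', ha', hab'⟩ := h.exists_adj hb
      exact hab (card_le_one.1 hA a (h.subset_A ha) a' ha' ▸ hab')
    rw [hA', card_empty] at h1
    have := Nat.mul_le_mul hA hp2
    omega
  · rcases Nat.lt_or_ge p #A with hM | hM
    · have := h.card_B_le hmax hp' hp1 hM hk
      omega
    -- Here `#A ≤ p` and `#B ≤ p ^ 2`. With `p = q + 1`, the total is at most `(q + 1) * q + 2 * (q
    -- + 1) ≤ 4 * k + 2`.
    · have h5 := h.card_core_le_add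
      have h6 := h4.trans (Nat.mul_le_mul_right p hM)
      obtain ⟨q, hq⟩ : ∃ q, p = q + 1 := ⟨p - 1, by omega⟩
      rw [hq, Nat.add_sub_cancel] at hp'
      rw [hq] at h6 hM hp2
      nlinarith

end Count

/-- In a positive instance, few vertices are kept. -/
theorem card_core_le (hC : IsSol G C k) : #(core G k) ≤ 9 * k + 1 := by
  have h : Count G k C (free G k ∩ C)
    ((free G k ∩ C).filter fun v => nonNbr G v C = ∅) (linked G k \ C) := ⟨hC, rfl, rfl, rfl⟩
  rcases Nat.lt_or_ge #((free G k ∩ C).filter fun v => nonNbr G v C = ∅) (2 * k + 2) with hm | hm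
  · exact h.card_core_le_of_small (by omega)
  · exact h.card_core_le_of_large hm

end Bound

end SplitKernel

/-! ### The program -/

namespace RAM

/-! ### Truth values and division as terms -/

namespace Term

/-- `0` if `t` is nonzero, and `1` otherwise. -/
def not (t : Term) : Term := .sub (.const 1) t

/-- The truth value of `s < t`. -/
def lt (s t : Term) : Term := not (not (.sub t s))

/-- The truth value of `s = t`. -/
def eq (s t : Term) : Term := not (.add (.sub s t) (.sub t s))

/-- The truth value of `s ≠ 0 ∨ t ≠ 0`. -/
def or (s t : Term) : Term := not (not (.add s t))

/-- `s` if `c` is nonzero, and `t` otherwise. -/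
def ite (c s t : Term) : Term := .add (.mul (not (not c)) s) (.mul (not c) t)

/-- The quotient of `s` by `t`, in which the variable `5` does not occur. -/
def div (s t : Term) : Term := .sum 5 s (not (lt s (.mul (.add (.var 5) (.const 1)) t)))

variable {α : ℕ → ℕ → ℕ} {ρ : ℕ → ℕ} {s t c : Term}

@[simp] theorem eval_not : (not t).eval α ρ = if t.eval α ρ = 0 then 1 else 0 := by
  simp only [not, eval]; split_ifs <;> omega

@[simp] theorem eval_lt : (lt s t).eval α ρ = if s.eval α ρ < t.eval α ρ then 1 else 0 := by
  simp only [lt, eval_not, eval]; grind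

@[simp] theorem eval_eq : (eq s t).eval α ρ = if s.eval α ρ = t.eval α ρ then 1 else 0 := by
  simp only [eq, eval_not, eval]; grind

@[simp] theorem eval_or :
    (or s t).eval α ρ = if s.eval α ρ ≠ 0 ∨ t.eval α ρ ≠ 0 then 1 else 0 := by
  simp only [or, eval_not, eval]; grind

@[simp] theorem eval_ite :
    (ite c s t).eval α ρ = if c.eval α ρ ≠ 0 then s.eval α ρ else t.eval α ρ := by
  simp only [ite, eval_not, eval]; split_ifs <;> simp_all

/-- The quotient is the number of `j` below `s` with `(j + 1) * t ≤ s`. -/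
theorem eval_div (hs : ∀ j, s.eval α (Function.update ρ 5 j) = s.eval α ρ)
    (ht : ∀ j, t.eval α (Function.update ρ 5 j) = t.eval α ρ) (h0 : 0 < t.eval α ρ) :
    (div s t).eval α ρ = s.eval α ρ / t.eval α ρ := by
  simp only [div, eval, eval_not, eval_lt, hs, ht, Function.update_self]
  have h : ∀ j, (if (if s.eval α ρ < (j + 1) * t.eval α ρ then 1 else 0) = 0 then 1 else 0) =
      if j < s.eval α ρ / t.eval α ρ then 1 else 0 := by
    intro j
    have := Nat.le_div_iff_mul_le h0 (x := j + 1) (y := s.eval α ρ)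
    by_cases hj : j < s.eval α ρ / t.eval α ρ
    · simp [hj, this.1 hj]
    · have : s.eval α ρ < (j + 1) * t.eval α ρ := by
        by_contra! h'
        exact hj (this.2 h')
      simp [hj, this]
  rw [Finset.sum_congr rfl fun j _ => h j, ← Finset.card_filter]
  have : (Finset.range (s.eval α ρ)).filter (· < s.eval α ρ / t.eval α ρ) =
      Finset.range (s.eval α ρ / t.eval α ρ) := by
    ext j
    have := Nat.div_le_self (s.eval α ρ) (t.eval α ρ)
    simp only [Finset.mem_filter, Finset.mem_range]
    omega
  rw [this, Finset.card_range]

end Term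

open Term

/-- The adjacency of the vertices `s` and `t`. -/
def adjTerm (s t : Term) : Term := .get 2 (.add (.mul s (.var 0)) t)

/-- The truth value of: `t` is different from `s` and not adjacent to `s`. -/
def nonadjTerm (s t : Term) : Term := .mul (not (eq t s)) (not (adjTerm s t))

/-- The tables of the kernelization. In the first one the graph is copied, or complemented; in the
last one the kernel is copied, or complemented. -/
def kernelTables (del : Bool) : List Table :=
  let n := Term.var 0
  let k := Term.var 1
  let x := Term.var 2
  let y := Term.var 3
  let z := Term.var 4
  let c := Term.get 10 (.const 0)
  let m := Term.get 11 (.const 0)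
  let no := Term.get 12 (.const 0)
  let N := Term.get 13 (.const 0)
  let i := Term.get 16 x
  let j := Term.sub x (.mul i N)
  let edge := Term.ite (lt i j) (.get 17 x) (ite (lt j i) (.get 17 (.add (.mul j N) i)) (.const 0))
  [ -- the adjacency matrix
   ⟨2, .mul n n, bif del then
      ite (eq (div x n) (.sub x (.mul (div x n) n))) (.const 0) (not (.get 0 x)) else .get 0 x⟩,
   -- the vertices with many non-edges in their neighbourhood
   ⟨3, n, lt (.mul (.const 2) k)
      (.sum 3 n (.mul (adjTerm x y) (.sum 4 n (.mul (adjTerm x z) (nonadjTerm y z)))))⟩,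
   -- the vertices that are forced out of the clique
   ⟨4, n, lt k (.sum 3 n (.mul (nonadjTerm x y)
      (lt k (.sum 4 n (.mul (nonadjTerm x z) (adjTerm y z))))))⟩,
   -- the vertices that are forced into the clique
   ⟨5, n, or (.get 3 x) (.sum 3 n (.mul (adjTerm x y) (.get 4 y)))⟩,
   -- the free vertices
   ⟨6, n, .mul (not (.get 5 x)) (not (.get 4 x))⟩,
   -- the linked vertices
   ⟨7, n, .mul (.get 6 x) (lt (.const 0) (.sum 3 n (.mul (adjTerm x y) (.get 6 y))))⟩,
   -- the weights
   ⟨8, n, .sum 3 n (.mul (.get 5 y) (nonadjTerm x y))⟩,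
   -- the kept vertices
   ⟨9, n, .mul (.get 7 x) (or (.get 8 x) (.sum 3 n (.mul (.get 7 y) (nonadjTerm x y))))⟩,
   -- the number of kept vertices
   ⟨10, .const 1, .sum 3 n (.get 9 y)⟩,
   -- the number of non-edges between forced vertices
   ⟨11, .const 1, .sum 3 n (.mul (.get 5 y) (.sum 4 n (.mul (.get 5 z) (nonadjTerm y z))))⟩,
   -- whether the instance is recognized as negative
   ⟨12, .const 1, or (lt (.add (.mul (.const 9) k) (.const 1)) c) (lt (.mul (.const 2) k) m)⟩,
   -- the number of vertices and the parameter of the kernel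
   ⟨13, .const 1, ite no (.const 4) (.add c (.add (.mul (.const 2) k) (.const 3)))⟩,
   ⟨14, .const 1, ite no (.const 0) (.sub k (div m (.const 2)))⟩,
   -- the enumeration of the kept vertices
   ⟨15, N, .sum 3 n (.mul y (.mul (.get 9 y) (eq (.sum 4 y (.get 9 z)) x)))⟩,
   -- the rows of the positions in the adjacency matrix of the kernel
   ⟨16, .mul N N, div x N⟩,
   -- the adjacency matrix above the diagonal
   ⟨17, .mul N N, ite no (.mul (eq j (.add i (.const 1))) (not (eq i (.const 1))))
      (ite (lt j c) (adjTerm (.get 15 i) (.get 15 j))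
        (ite (lt j (.add c (.add k (.const 1))))
          (ite (lt i c) (not (lt (.sub j c) (.get 8 (.get 15 i)))) (.const 1))
          (.mul (not (lt i c)) (lt i (.add c (.add k (.const 1)))))))⟩,
   -- the adjacency matrix
   ⟨1, .mul N N, bif del then ite (eq i j) (.const 0) (not edge) else lt (.const 0) edge⟩]

theorem kernelTables_wf (del : Bool) : tablesWf 10 [0] (kernelTables del) := by
  cases del <;> decide

/-- The kernelization. First the parameter is replaced by the minimum of `k` and `n ^ 2`. -/
def kernelProg (del : Bool) : Prog :=
  .seq (.set 10 (.reg 1)) (.seq (.set 1 (.const 0)) (.seq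
    ((Term.mul (.var 0) (.var 0)).compile 11) (.seq
    -- With truncated subtraction, `a - (a - b)` is the minimum of `a` and `b`.
    (.set 1 (.sub (.reg 10) (.sub (.reg 10) (.reg 11)))) (.seq
    (tablesProg 10 (kernelTables del)) (.seq
    (.set 0 (.get 13 (.const 0))) (.set 1 (.get 14 (.const 0))))))))

/-- The variables that hold the input. -/
def inputVars (n k : ℕ) (r : ℕ) : ℕ := if r = 0 then n else if r = 1 then k else 0

/-- While `n * n` is computed, `k` waits in register `10`, outside the registers whose values enter
the time bound. It returns only after it has been cut down to at most `n * n`. -/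
theorem exists_polynomial_runs_kernelProg (del : Bool) : ∃ P : Polynomial ℕ, ∀ I : GraphInstance,
    Runs (kernelProg del) I.inputState (P.eval I.size) fun τ =>
      τ.reg 0 = τ.arr 13 0 ∧ τ.reg 1 = τ.arr 14 0 ∧ τ.arr 0 = I.inputState.arr 0 ∧
        ∀ T ∈ kernelTables del,
          ∀ i < T.bound.eval τ.arr (inputVars I.n (min I.k (I.n * I.n))),
            τ.arr T.arr i =
              T.body.eval τ.arr (Function.update (inputVars I.n (min I.k (I.n * I.n))) 2 i) := by
  obtain ⟨P, hP⟩ := exists_polynomial_computes (m := 10) (S := []) (.mul (.var 0) (.var 0))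
    (by decide)
  obtain ⟨Q, hQ⟩ := exists_polynomial_runs_tablesProg (m := 10) (by omega) _ _ (kernelTables_wf del)
  refine ⟨.C 2 + (.C 2 + (P + (.C 6 + (Q.comp (.X + .C 1) + (.C 3 + .C 3))))), fun I => ?_⟩
  simp only [Polynomial.eval_add, Polynomial.eval_C, Polynomial.eval_comp, Polynomial.eval_X]
  have hsize : I.n * I.n ≤ I.size := by rw [GraphInstance.size, sq]; omega
  have hn : I.n ≤ I.n * I.n := Nat.le_mul_self _
  refine (runs_set (Q := fun τ => τ.reg 0 = I.n ∧ τ.reg 10 = I.k ∧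
    (∀ r < 10, 2 ≤ r → τ.reg r = 0) ∧ τ.arr = I.inputState.arr) ?_).seq
    fun τ₁ hτ₁ => (runs_set (Q := fun τ => τ.reg 0 = I.n ∧ τ.reg 10 = I.k ∧
    (∀ r < 10, 1 ≤ r → τ.reg r = 0) ∧ τ.arr = I.inputState.arr) ?_).seq
    fun τ₂ hτ₂ => (((hP I.size τ₂ ⟨fun r hr => ?_, by simp⟩).2 11 (by omega)).mono le_rfl
      (Q' := fun τ => τ.reg 0 = I.n ∧ τ.reg 10 = I.k ∧ τ.reg 11 = I.n * I.n ∧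
        (∀ r < 10, 1 ≤ r → τ.reg r = 0) ∧ τ.arr = I.inputState.arr) fun τ h => ?_).seq
    fun τ₃ hτ₃ => (runs_set (Q := fun τ =>
      (∀ r < 10, τ.reg r = inputVars I.n (min I.k (I.n * I.n)) r) ∧
      τ.arr = I.inputState.arr) ?_).seq
    fun τ₄ hτ₄ => (hQ (I.size + 1) τ₄ (fun r hr => ?_) (fun a i => ?_) ?_).seq
    fun τ₅ hτ₅ => (runs_set (Q := fun τ => τ.reg 0 = τ₅.arr 13 0 ∧ τ.arr = τ₅.arr) ?_).seq
    fun τ₆ hτ₆ => runs_set ?_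
  · refine ⟨by simp [GraphInstance.inputState], by simp [Exp.eval, GraphInstance.inputState],
      fun r hr hr2 => ?_, rfl⟩
    rw [State.setReg_reg, if_neg (by omega)]
    simp only [GraphInstance.inputState]
    rw [if_neg (by omega), if_neg (by omega)]
  · obtain ⟨h1, h2, h3, h4⟩ := hτ₁
    refine ⟨by simp [h1], by simp [h2], fun r hr hr1 => ?_, h4⟩
    rw [State.setReg_reg]
    split_ifs with h
    · rfl
    · exact h3 r hr (by omega)
  · obtain ⟨h1, h2, h3, h4⟩ := hτ₂
    rcases Nat.eq_zero_or_pos r with rfl | hr0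
    · omega
    · rw [h3 r hr hr0]; omega
  · obtain ⟨h1, h2, h3, h4⟩ := hτ₂
    obtain ⟨g1, g2, g3⟩ := h
    exact ⟨by rw [g2 0 (by omega), h1], by rw [g2 10 (by omega), h2], by simp [g1, Term.eval, h1],
      fun r hr hr1 => by rw [g2 r (by omega), h3 r hr hr1], by rw [g3, h4]⟩
  · obtain ⟨h1, h2, h3, h4, h5⟩ := hτ₃
    refine ⟨fun r hr => ?_, h5⟩
    simp only [State.setReg_reg, Exp.eval, inputVars, h2, h3]
    rcases Nat.lt_or_ge r 2 with hr2 | hr2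
    · interval_cases r
      · simp [h1]
      · simp; omega
    · rw [if_neg (by omega), if_neg (by omega), if_neg (by omega), h4 r hr (by omega)]
  · rw [hτ₄.1 r hr, inputVars]
    split_ifs <;> omega
  · rw [hτ₄.2]
    simp only [GraphInstance.inputState]
    split_ifs <;> omega
  · rw [hτ₄.1 2 (by omega)]; rfl
  · exact ⟨by simp [Exp.eval], rfl⟩
  · obtain ⟨h1, h2, h3⟩ := hτ₅
    obtain ⟨h4, h5⟩ := hτ₆
    refine ⟨by simp [h4, h5], by simp [Exp.eval, h5], ?_, ?_⟩
    · rw [State.setReg_arr, h5, h2 0 (by simp), hτ₄.2]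
    · rw [State.setReg_arr, h5]
      exact h3 _ fun r hr => (hτ₄.1 r hr).symm

end RAM

/-! ### The tables of the program -/

namespace SplitKernel

open Finset RAM

theorem row_div {N u v : ℕ} (hv : v < N) : (u * N + v) / N = u := by
  rw [Nat.add_comm, Nat.add_mul_div_right _ _ (by omega), Nat.div_eq_of_lt hv, zero_add]

theorem row_lt {N u v : ℕ} (hu : u < N) (hv : v < N) : u * N + v < N * N := by
  nlinarith

/-! ### Cardinalities as sums of truth values -/

section Sums

variable {V : Type*} [DecidableEq V] [Fintype V] {G : SimpleGraph V} [DecidableRel G.Adj]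

theorem card_filter_filter_eq_sum {V : Type*} [Fintype V] (p q : V → Prop) [DecidablePred p]
    [DecidablePred q] :
    #((univ.filter p).filter q) = ∑ v, (if p v then 1 else 0) * (if q v then 1 else 0) := by
  rw [filter_filter, card_filter]
  refine sum_congr rfl fun v _ => ?_
  by_cases h : p v <;> simp [h]

theorem card_nonNbr_eq_sum (v : V) (S : Finset V) : #(nonNbr G v S) =
    ∑ u, (if u ∈ S then 1 else 0) * (if u ≠ v ∧ ¬ G.Adj v u then 1 else 0) := by
  rw [← card_filter_filter_eq_sum, nonNbr]
  congr 2
  ext; simp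

theorem miss_eq_sum (S : Finset V) : miss G S = ∑ v, (if v ∈ S then 1 else 0) *
    ∑ u, (if u ∈ S then 1 else 0) * (if u ≠ v ∧ ¬ G.Adj v u then 1 else 0) := by
  rw [sum_congr rfl fun v _ => by rw [← card_nonNbr_eq_sum]]
  simp only [ite_mul, one_mul, zero_mul, miss, sum_ite_mem, univ_inter]

theorem sum_mul_pos_iff {V : Type*} [Fintype V] (p q : V → Prop) [DecidablePred p]
    [DecidablePred q] :
    0 < ∑ v, (if p v then 1 else 0) * (if q v then 1 else 0) ↔ ∃ v, p v ∧ q v := by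
  rw [← card_filter_filter_eq_sum, card_pos, filter_filter]
  simp [Finset.Nonempty]

end Sums

/-- The graph that the program works on. -/
def workGraph {n : ℕ} (del : Bool) (G : SimpleGraph (Fin n)) : SimpleGraph (Fin n) :=
  bif del then Gᶜ else G

/-- The array entries `α` are those that the tables prescribe. -/
def Filled (del : Bool) (n k : ℕ) (α : ℕ → ℕ → ℕ) : Prop :=
  ∀ T ∈ kernelTables del, ∀ i < T.bound.eval α (inputVars n k),
    α T.arr i = T.body.eval α (Function.update (inputVars n k) 2 i)

/-- The defining equations of the tables between the first and the last one. -/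
structure TableEqs (n k : ℕ) (α : ℕ → ℕ → ℕ) (adj : ℕ → ℕ → ℕ) (nonadj : ℕ → ℕ → ℕ) : Prop where
  dense : ∀ i < n, α 3 i = if 2 * k < ∑ y ∈ range n, adj i y * ∑ z ∈ range n,
    adj i z * nonadj y z then 1 else 0
  out : ∀ i < n, α 4 i = if k < ∑ y ∈ range n, nonadj i y *
    (if k < ∑ z ∈ range n, nonadj i z * adj y z then 1 else 0) then 1 else 0
  inn : ∀ i < n, α 5 i = if α 3 i ≠ 0 ∨ ∑ y ∈ range n, adj i y * α 4 y ≠ 0 then 1 else 0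
  free : ∀ i < n, α 6 i = (if α 5 i = 0 then 1 else 0) * if α 4 i = 0 then 1 else 0
  linked : ∀ i < n, α 7 i = α 6 i * if 0 < ∑ y ∈ range n, adj i y * α 6 y then 1 else 0
  weight : ∀ i < n, α 8 i = ∑ y ∈ range n, α 5 y * nonadj i y
  core : ∀ i < n, α 9 i = α 7 i *
    if α 8 i ≠ 0 ∨ ∑ y ∈ range n, α 7 y * nonadj i y ≠ 0 then 1 else 0
  size : α 10 0 = ∑ i ∈ range n, α 9 i
  miss : α 11 0 = ∑ y ∈ range n, α 5 y * ∑ z ∈ range n, α 5 z * nonadj y z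
  no : α 12 0 ≠ 0 ↔ 9 * k + 1 < α 10 0 ∨ 2 * k < α 11 0
  verts : α 13 0 = if α 12 0 ≠ 0 then 4 else α 10 0 + (2 * k + 3)
  param : α 14 0 = if α 12 0 ≠ 0 then 0 else k - α 11 0 / 2
  enum : ∀ i < α 13 0, α 15 i = ∑ y ∈ range n, y * (α 9 y *
    if ∑ z ∈ range y, α 9 z = i then 1 else 0)
  upper : ∀ i < α 13 0, ∀ j < α 13 0, α 17 (i * α 13 0 + j) =
    if α 12 0 ≠ 0 then (if j = i + 1 ∧ i ≠ 1 then 1 else 0)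
    else if j < α 10 0 then adj (α 15 i) (α 15 j)
    else if j < α 10 0 + (k + 1) then
      (if i < α 10 0 then (if j - α 10 0 < α 8 (α 15 i) then 0 else 1) else 1)
    else (if α 10 0 ≤ i ∧ i < α 10 0 + (k + 1) then 1 else 0)

set_option maxHeartbeats 1000000 in
theorem Filled.tableEqs {del : Bool} {n k : ℕ} {α : ℕ → ℕ → ℕ} (h : Filled del n k α) :
    TableEqs n k α (fun u v => α 2 (u * n + v))
      (fun u v => (if (if v = u then 1 else 0) = 0 then 1 else 0) *
        if α 2 (u * n + v) = 0 then 1 else 0) := by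
  simp only [Filled, kernelTables, List.forall_mem_cons] at h
  obtain ⟨-, h3, h4, h5, h6, h7, h8, h9, h10, h11, h12, h13, h14, h15, h16, h17, -⟩ := h
  simp only [Term.eval, adjTerm, nonadjTerm, Term.eval_not, Term.eval_lt, Term.eval_eq,
    Term.eval_or, Term.eval_ite, Function.update_apply, inputVars, OfNat.ofNat_ne_zero,
    OfNat.ofNat_ne_one, Nat.reduceEqDiff, ite_true, ite_false, one_ne_zero, zero_ne_one,
    OfNat.zero_ne_ofNat, OfNat.one_ne_ofNat] at h3 h4 h5 h6 h7 h8 h9 h10 h11 h12 h13 h14 h15 h16 h17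
  have hrow : ∀ i < α 13 0, ∀ j < α 13 0, α 16 (i * α 13 0 + j) = i := by
    intro i hi j hj
    rw [h16 _ (row_lt hi hj), Term.eval_div (fun _ => rfl) (fun _ => rfl)
      (by simp only [Term.eval]; omega)]
    exact row_div hj
  refine ⟨h3, h4, h5, h6, h7, h8, h9, h10 0 Nat.zero_lt_one, h11 0 Nat.zero_lt_one, ?_,
    h13 0 Nat.zero_lt_one, ?_, h15, fun i hi j hj => ?_⟩
  · rw [h12 0 Nat.zero_lt_one]
    simp only [ne_eq, ite_eq_right_iff, one_ne_zero, imp_false, not_not]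
  · rw [h14 0 Nat.zero_lt_one, Term.eval_div (fun _ => rfl) (fun _ => rfl) (by simp [Term.eval])]
    rfl
  · rw [h17 _ (row_lt hi hj)]
    simp only [hrow i hi j hj, Nat.add_sub_cancel_left]
    clear h3 h4 h5 h6 h7 h8 h9 h10 h11 h12 h13 h14 h15 h16 h17 hrow hi hj
    split_ifs <;> grind

/-- The last table holds the adjacency matrix of the graph with the edges of the last but one, or
of the complement. -/
theorem Filled.output {del : Bool} {n k : ℕ} {α : ℕ → ℕ → ℕ} (h : Filled del n k α) {i j : ℕ}
    (hi : i < α 13 0) (hj : j < α 13 0) : α 1 (i * α 13 0 + j) =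
      bif del then (if i ≠ j ∧ ¬ (i < j ∧ α 17 (i * α 13 0 + j) ≠ 0 ∨
        j < i ∧ α 17 (j * α 13 0 + i) ≠ 0) then 1 else 0)
      else if i < j ∧ α 17 (i * α 13 0 + j) ≠ 0 ∨ j < i ∧ α 17 (j * α 13 0 + i) ≠ 0
        then 1 else 0 := by
  have hij := row_lt hi hj
  simp only [Filled, kernelTables, List.forall_mem_cons] at h
  obtain ⟨-, -, -, -, -, -, -, -, -, -, -, -, -, -, h16, -, h1, -⟩ := h
  have hrow : α 16 (i * α 13 0 + j) = i := by
    rw [h16 _ hij, Term.eval_div (fun _ => rfl) (fun _ => rfl) (by simp only [Term.eval]; omega)]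
    exact row_div hj
  rw [h1 _ hij]
  clear h16 h1
  cases del
  · simp only [Term.eval, Term.eval_lt, Term.eval_ite, cond_false, Function.update_self, hrow,
      Nat.add_sub_cancel_left]
    split_ifs <;> grind
  · simp only [Term.eval, Term.eval_not, Term.eval_lt, Term.eval_eq, Term.eval_ite, cond_true,
      Function.update_self, hrow, Nat.add_sub_cancel_left]
    split_ifs <;> grind

theorem Filled.adj {del : Bool} {k : ℕ} {α : ℕ → ℕ → ℕ} (I : GraphInstance)
    (h : Filled del I.n k α) (h0 : α 0 = I.inputState.arr 0)
    [DecidableRel (workGraph del I.graph).Adj] (u v : Fin I.n) :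
    α 2 (u * I.n + v) = if (workGraph del I.graph).Adj u v then 1 else 0 := by
  have huv := row_lt u.2 v.2
  simp only [Filled, kernelTables, List.forall_mem_cons] at h
  have h2 := h.1 _ (by simpa [Term.eval, inputVars] using huv)
  have hin : α 0 (u * I.n + v) ≠ 0 ↔ I.graph.Adj u v := by
    rw [h0]
    simp only [GraphInstance.inputState, true_and, ne_eq, ite_eq_right_iff, one_ne_zero, imp_false,
      not_not]
    constructor
    · rintro ⟨u', v', h', h''⟩
      have h3 := congrArg (· / I.n) h'
      simp only [row_div v.2, row_div v'.2] at h3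
      rw [h3] at h'
      rwa [Fin.ext h3, Fin.ext (Nat.add_left_cancel h')]
    · intro h
      exact ⟨u, v, rfl, h⟩
  have hin1 : α 0 (u * I.n + v) ≤ 1 := by
    rw [h0]; simp only [GraphInstance.inputState]; split_ifs <;> omega
  have hwork : (workGraph del I.graph).Adj u v ↔
      bif del then u ≠ v ∧ ¬ I.graph.Adj u v else I.graph.Adj u v := by
    cases del <;> simp [workGraph]
  rw [h2]
  cases del
  · simp only [cond_false] at hwork
    simp only [Term.eval, cond_false, Function.update_self, hwork, ← hin]
    split_ifs <;> omega
  · have hn : 0 < I.n := u.pos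
    have h0' : inputVars I.n k 0 = I.n := rfl
    have hdiv : Term.eval α (Function.update (inputVars I.n k) 2 (u * I.n + v))
        (.div (.var 2) (.var 0)) = u := by
      rw [Term.eval_div (fun _ => rfl) (fun _ => rfl) (by simpa [Term.eval, inputVars] using hn)]
      simp only [Term.eval, Function.update_self]
      rw [Function.update_of_ne (by omega), h0']
      exact row_div v.2
    simp only [cond_true] at hwork
    simp only [cond_true, Term.eval_ite, Term.eval_eq, Term.eval_not, Term.eval, hdiv,
      Function.update_apply, OfNat.zero_ne_ofNat, if_true, if_false, h0', Nat.add_sub_cancel_left,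
      hwork, ← hin, ne_eq, Fin.ext_iff]
    split_ifs <;> grind

end SplitKernel

/-! ### The contents of the tables -/

namespace SplitKernel

open Finset RAM

theorem card_filter_fin_Ico {N a b : ℕ} (h : b ≤ N) :
    #(univ.filter fun j : Fin N => a ≤ (j : ℕ) ∧ (j : ℕ) < b) = b - a := by
  rw [← Nat.card_Ico, ← card_map Fin.valEmbedding]
  congr 1
  ext j
  simp only [mem_map, mem_filter, mem_univ, true_and, Fin.valEmbedding_apply, mem_Ico]
  constructor
  · rintro ⟨i, hi, rfl⟩; exact hi
  · intro hj; exact ⟨⟨j, by omega⟩, hj, rfl⟩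

/-- The position of `u` in the increasing enumeration of `S`. -/
def rank {n : ℕ} (S : Finset (Fin n)) (u : Fin n) : ℕ := #(S.filter (· < u))

theorem rank_lt {n : ℕ} {S : Finset (Fin n)} {u : Fin n} (hu : u ∈ S) : rank S u < #S :=
  card_lt_card ⟨filter_subset _ _, fun h => lt_irrefl u (mem_filter.1 (h hu)).2⟩

theorem rank_strictMonoOn {n : ℕ} (S : Finset (Fin n)) : StrictMonoOn (rank S) S := by
  intro u hu v _ huv
  refine card_lt_card ⟨fun w hw => ?_, fun h => ?_⟩
  · rw [mem_filter] at hw ⊢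
    exact ⟨hw.1, hw.2.trans huv⟩
  · exact lt_irrefl u (mem_filter.1 (h (mem_filter.2 ⟨hu, huv⟩))).2

theorem exists_rank_eq {n : ℕ} (S : Finset (Fin n)) {i : ℕ} (hi : i < #S) :
    ∃ u ∈ S, rank S u = i := by
  have h : S.image (rank S) = range #S := by
    refine eq_of_subset_of_card_le (fun j hj => ?_) ?_
    · obtain ⟨u, hu, rfl⟩ := mem_image.1 hj
      exact mem_range.2 (rank_lt hu)
    · rw [card_image_of_injOn (rank_strictMonoOn S).injOn, card_range]
  have := mem_range.2 hi
  rw [← h, mem_image] at this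
  exact this

theorem sum_range_indicator {n : ℕ} (S : Finset (Fin n)) {f : ℕ → ℕ}
    (hf : ∀ u : Fin n, f u = if u ∈ S then 1 else 0) (u : Fin n) :
    ∑ z ∈ range u, f z = rank S u := by
  have h : range (u : ℕ) = (range n).filter (· < (u : ℕ)) := by
    ext z; simp only [mem_range, mem_filter]; omega
  rw [h, sum_filter, sum_range, rank, ← filter_univ_mem S, filter_filter, card_filter]
  refine sum_congr rfl fun z _ => ?_
  rw [hf]
  by_cases h1 : z ∈ S <;> by_cases h2 : z < u <;> simp [h1, h2]

/-- `adj` and `nonadj` are the truth values of adjacency and of nonadjacency of different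
vertices. -/
structure Represents {n : ℕ} (H : SimpleGraph (Fin n)) [DecidableRel H.Adj]
    (adj nonadj : ℕ → ℕ → ℕ) : Prop where
  adj : ∀ u v : Fin n, adj u v = if H.Adj u v then 1 else 0
  nonadj : ∀ u v : Fin n, nonadj u v = if v ≠ u ∧ ¬ H.Adj u v then 1 else 0

namespace TableEqs

variable {n k : ℕ} {α adj nonadj : ℕ → ℕ → ℕ} {H : SimpleGraph (Fin n)} [DecidableRel H.Adj]

theorem dense_eq (e : TableEqs n k α adj nonadj) (hH : Represents H adj nonadj)
    (u : Fin n) : α 3 u = if u ∈ denseForced H k then 1 else 0 := by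
  rw [e.dense u u.2, sum_range]
  simp only [sum_range, hH.adj, hH.nonadj]
  have := miss_eq_sum (G := H) (H.neighborFinset u)
  simp only [SimpleGraph.mem_neighborFinset] at this
  rw [← this]
  simp [denseForced]

theorem out_eq (e : TableEqs n k α adj nonadj) (hH : Represents H adj nonadj)
    (u : Fin n) : α 4 u = if u ∈ forcedOut H k then 1 else 0 := by
  rw [e.out u u.2, sum_range]
  simp only [sum_range, hH.adj, hH.nonadj, ← card_filter_filter_eq_sum]
  refine if_congr ?_ rfl rfl
  rw [forcedOut, mem_filter, and_iff_right (mem_univ u)]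
  exact Iff.rfl

theorem inn_eq (e : TableEqs n k α adj nonadj) (hH : Represents H adj nonadj)
    (u : Fin n) : α 5 u = if u ∈ forcedIn H k then 1 else 0 := by
  rw [e.inn u u.2, sum_range]
  simp only [e.dense_eq hH, e.out_eq hH, hH.adj, ← Nat.pos_iff_ne_zero, sum_mul_pos_iff]
  by_cases h : u ∈ denseForced H k <;> simp [forcedIn, h]

theorem free_eq (e : TableEqs n k α adj nonadj) (hH : Represents H adj nonadj)
    (u : Fin n) : α 6 u = if u ∈ SplitKernel.free H k then 1 else 0 := by
  rw [e.free u u.2, e.inn_eq hH, e.out_eq hH]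
  by_cases h1 : u ∈ forcedIn H k <;> by_cases h2 : u ∈ forcedOut H k <;>
    simp [SplitKernel.free, h1, h2]

theorem linked_eq (e : TableEqs n k α adj nonadj) (hH : Represents H adj nonadj)
    (u : Fin n) : α 7 u = if u ∈ SplitKernel.linked H k then 1 else 0 := by
  rw [e.linked u u.2, sum_range]
  simp only [e.free_eq hH, hH.adj, sum_mul_pos_iff]
  by_cases h1 : u ∈ SplitKernel.free H k <;> simp [SplitKernel.linked, h1]

theorem weight_eq (e : TableEqs n k α adj nonadj) (hH : Represents H adj nonadj)
    (u : Fin n) : α 8 u = SplitKernel.weight H k u := by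
  rw [e.weight u u.2, sum_range]
  simp only [e.inn_eq hH, hH.nonadj]
  rw [SplitKernel.weight, card_nonNbr_eq_sum]

theorem core_eq (e : TableEqs n k α adj nonadj) (hH : Represents H adj nonadj)
    (u : Fin n) : α 9 u = if u ∈ SplitKernel.core H k then 1 else 0 := by
  rw [e.core u u.2, sum_range]
  simp only [e.linked_eq hH, e.weight_eq hH, hH.nonadj, ← Nat.pos_iff_ne_zero,
    sum_mul_pos_iff]
  have : (∃ v, v ∈ SplitKernel.linked H k ∧ v ≠ u ∧ ¬ H.Adj u v) ↔
    ∃ v, v ≠ u ∧ v ∈ SplitKernel.linked H k ∧ ¬ H.Adj u v := by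
    refine exists_congr fun v => ?_
    tauto
  simp only [this]
  by_cases h1 : u ∈ SplitKernel.linked H k <;> simp [SplitKernel.core, h1]

theorem size_eq (e : TableEqs n k α adj nonadj) (hH : Represents H adj nonadj)
    : α 10 0 = #(SplitKernel.core H k) := by
  rw [e.size, sum_range]
  simp only [e.core_eq hH]
  simp

theorem miss_eq (e : TableEqs n k α adj nonadj) (hH : Represents H adj nonadj)
    : α 11 0 = SplitKernel.miss H (forcedIn H k) := by
  rw [e.miss, sum_range]
  simp only [sum_range, e.inn_eq hH, hH.nonadj]
  rw [miss_eq_sum]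

/-- In the sum only the core vertex of the given rank survives, since ranks are injective on the
core. -/
theorem enum_eq (e : TableEqs n k α adj nonadj) (hH : Represents H adj nonadj)
    {u : Fin n} (hu : u ∈ SplitKernel.core H k)
    (hlt : rank (SplitKernel.core H k) u < α 13 0) :
    α 15 (rank (SplitKernel.core H k) u) = u := by
  rw [e.enum _ hlt, sum_range]
  simp only [sum_range_indicator _ (e.core_eq hH)]
  rw [sum_eq_single u]
  · rw [e.core_eq hH, if_pos hu, if_pos rfl, mul_one, mul_one]
  · intro v _ hvu
    rw [e.core_eq hH]
    by_cases hv : v ∈ SplitKernel.core H k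
    · rw [if_neg fun h => hvu ((rank_strictMonoOn _).injOn hv hu h), mul_zero, mul_zero]
    · rw [if_neg hv, zero_mul, mul_zero]
  · simp

end TableEqs

/-! ### The kernel -/

/-- The graph whose edges are given by the table `17`. -/
def tableGraph (α : ℕ → ℕ → ℕ) : SimpleGraph (Fin (α 13 0)) where
  Adj i j := i < j ∧ α 17 (i * α 13 0 + j) ≠ 0 ∨ j < i ∧ α 17 (j * α 13 0 + i) ≠ 0
  symm := ⟨fun _ _ h => h.symm⟩
  loopless := ⟨fun i h => h.elim (fun h => lt_irrefl i h.1) fun h => lt_irrefl i h.1⟩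

instance (α : ℕ → ℕ → ℕ) : DecidableRel (tableGraph α).Adj := fun i j =>
  inferInstanceAs (Decidable (i < j ∧ α 17 (i * α 13 0 + j) ≠ 0 ∨
    j < i ∧ α 17 (j * α 13 0 + i) ≠ 0))

theorem tableGraph_adj_of_lt {α : ℕ → ℕ → ℕ} {i j : Fin (α 13 0)} (h : i < j) :
    (tableGraph α).Adj i j ↔ α 17 (i * α 13 0 + j) ≠ 0 := by
  simp [tableGraph, h, h.le]

namespace TableEqs

variable {n k : ℕ} {α adj nonadj : ℕ → ℕ → ℕ} {H : SimpleGraph (Fin n)} [DecidableRel H.Adj]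

/-- If the instance is recognized as negative, then the kernel is negative. -/
theorem not_exists_isSol_of_no (e : TableEqs n k α adj nonadj)
    (hno : α 12 0 ≠ 0) :
    ¬ ∃ D, IsSol (tableGraph α) D (α 14 0) := by
  rintro ⟨D, hD⟩
  have hN : α 13 0 = 4 := by rw [e.verts, if_pos hno]
  have hk : α 14 0 = 0 := by rw [e.param, if_pos hno]
  -- The edges are `01` and `23`. With parameter `0` the set `D` is a clique that meets both, but no
  -- edge joins them.
  have hA : ∀ i j : Fin (α 13 0), i < j →
      ((tableGraph α).Adj i j ↔ (j : ℕ) = i + 1 ∧ (i : ℕ) ≠ 1) := by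
    intro i j hij
    rw [tableGraph_adj_of_lt hij, e.upper i i.2 j j.2, if_pos hno]
    simp
  have hcl : ∀ i ∈ D, ∀ j ∈ D, i < j → (tableGraph α).Adj i j := by
    intro i hi j hj hij
    by_contra h
    have h1 := card_nonNbr_le hD hi
    have h2 := card_pos.2 ⟨j, mem_nonNbr.2 ⟨hj, hij.ne', h⟩⟩
    omega
  have h1 : ∃ i ∈ D, (i : ℕ) < 2 := by
    by_contra! h
    refine hD.1 ⟨0, by omega⟩ (fun h' => absurd (h _ h') (by simp)) ⟨1, by omega⟩
      (fun h' => absurd (h _ h') (by simp)) ((hA _ _ (by simp [Fin.lt_def])).2 (by simp))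
  have h2 : ∃ i ∈ D, 2 ≤ (i : ℕ) := by
    by_contra! h
    refine hD.1 ⟨2, by omega⟩ (fun h' => absurd (h _ h') (by simp)) ⟨3, by omega⟩
      (fun h' => absurd (h _ h') (by simp)) ((hA _ _ (by simp [Fin.lt_def])).2 (by simp))
  obtain ⟨i, hi, hi2⟩ := h1
  obtain ⟨j, hj, hj2⟩ := h2
  have hij : i < j := Fin.lt_def.2 (by omega)
  have := (hA i j hij).1 (hcl i hi j hj hij)
  omega

/-- If the instance is not recognized as negative, then the kernel is a gadget. -/
theorem exists_isGadget (e : TableEqs n k α adj nonadj) (hH : Represents H adj nonadj)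
    (hno : α 12 0 = 0) : ∃ P Q R g, IsGadget (tableGraph α) H k P Q R g := by
  have hN : α 13 0 = α 10 0 + (2 * k + 3) := by rw [e.verts, if_neg (by simpa using hno)]
  have hc := e.size_eq hH
  obtain ⟨c, hcd⟩ : ∃ c, α 10 0 = c := ⟨_, rfl⟩
  rw [hcd] at hN hc
  set S := SplitKernel.core H k
  have hS : ∀ i j : Fin (α 13 0), i < j → ((tableGraph α).Adj i j ↔
      if (j : ℕ) < c then adj (α 15 i) (α 15 j) ≠ 0
      else if (j : ℕ) < c + (k + 1) then ((i : ℕ) < c → α 8 (α 15 i) ≤ j - c)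
      else c ≤ (i : ℕ) ∧ (i : ℕ) < c + (k + 1)) := by
    intro i j hij
    rw [tableGraph_adj_of_lt hij, e.upper i i.2 j j.2, if_neg (by simpa using hno),
      hcd]
    split_ifs <;> simp <;> omega
  have hlt : ∀ u ∈ S, rank S u < α 13 0 := fun u hu => by
    have := rank_lt hu
    omega
  obtain ⟨g, hg⟩ : ∃ g : Fin n → Fin (α 13 0), ∀ u ∈ S, (g u : ℕ) = rank S u :=
    -- Outside the core the value is irrelevant; `0` is a vertex because there are at least three.
    ⟨fun u => if h : rank S u < α 13 0 then ⟨rank S u, h⟩ else ⟨0, by omega⟩,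
      fun u hu => by simp [hlt u hu]⟩
  have hgc : ∀ u ∈ S, (g u : ℕ) < c := fun u hu => by
    rw [hg u hu, hc]; exact rank_lt hu
  have henum : ∀ u ∈ S, α 15 (g u) = u := fun u hu => by
    rw [hg u hu]; exact e.enum_eq hH hu (hlt u hu)
  have hinj : Set.InjOn g S := fun u hu v hv huv =>
    (rank_strictMonoOn S).injOn hu hv (by rw [← hg u hu, ← hg v hv, huv])
  have hadj' : ∀ u ∈ S, ∀ v ∈ S, u < v → ((tableGraph α).Adj (g u) (g v) ↔ H.Adj u v) := by
    intro u hu v hv huv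
    have hlt : g u < g v := by
      rw [Fin.lt_def, hg u hu, hg v hv]; exact rank_strictMonoOn S hu hv huv
    rw [hS _ _ hlt, if_pos (hgc v hv), henum u hu, henum v hv, hH.adj]
    simp
  refine ⟨univ.filter fun i => (i : ℕ) < c,
    univ.filter fun i => c ≤ (i : ℕ) ∧ (i : ℕ) < c + (k + 1),
    univ.filter fun i => c + (k + 1) ≤ (i : ℕ) ∧ (i : ℕ) < α 13 0, g, ?_, ?_, ?_, hinj, ?_, ?_, ?_,
    ?_, ?_, ?_, ?_⟩
  · intro i
    simp only [mem_filter, mem_univ, true_and, i.2, and_true]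
    omega
  · rw [disjoint_left]
    intro i hi hi'
    simp only [mem_filter, mem_univ, true_and] at hi hi'
    omega
  · ext i
    simp only [mem_image, mem_filter, mem_univ, true_and]
    constructor
    · rintro ⟨u, hu, rfl⟩; exact hgc u hu
    · intro hi
      obtain ⟨u, hu, hui⟩ := exists_rank_eq S (hc ▸ hi)
      exact ⟨u, hu, Fin.ext (by rw [hg u hu, hui])⟩
  · intro u hu v hv
    rcases lt_trichotomy u v with huv | rfl | huv
    · exact hadj' u hu v hv huv
    · simp
    · rw [SimpleGraph.adj_comm, hadj' v hv u hu huv, SimpleGraph.adj_comm]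
  · intro i hi j hj hij
    simp only [mem_filter, mem_univ, true_and] at hi hj
    have hcl : ∀ i j : Fin (α 13 0), c ≤ (i : ℕ) → c ≤ (j : ℕ) → (j : ℕ) < c + (k + 1) → i < j →
        (tableGraph α).Adj i j := by
      intro i j hi hj hj' hij
      rw [hS i j hij, if_neg (by omega), if_pos hj']
      intro h; omega
    rcases lt_or_gt_of_ne hij with hij | hij
    · exact hcl i j hi.1 hj.1 hj.2 hij
    · exact (hcl j i hj.1 hi.1 hi.2 hij).symm
  · intro i hi j hj
    simp only [mem_filter, mem_univ, true_and] at hi hj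
    rw [hS i j (Fin.lt_def.2 (by omega)), if_neg (by omega), if_neg (by omega)]
    exact hi
  · intro i hi j hj
    simp only [mem_filter, mem_univ, true_and] at hi hj
    have hcl : ∀ i j : Fin (α 13 0), c + (k + 1) ≤ (i : ℕ) → i < j →
        ¬ (tableGraph α).Adj i j := by
      intro i j hi hij
      have := Fin.lt_def.1 hij
      rw [hS i j hij, if_neg (by omega), if_neg (by omega)]
      omega
    rcases lt_trichotomy i j with hij | rfl | hij
    · exact hcl i j hi.1 hij
    · simp
    · exact fun h => hcl j i hj.1 hij h.symm
  · intro i hi j hj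
    simp only [mem_filter, mem_univ, true_and] at hi hj
    rw [hS i j (Fin.lt_def.2 (by omega)), if_neg (by omega), if_neg (by omega)]
    omega
  · intro u hu
    -- The nonneighbours of `g u` in `Q` form an initial segment `[c, c + min weight (k + 1))`.
    have hle : c + min (SplitKernel.weight H k u) (k + 1) ≤ α 13 0 := by omega
    have h1 := card_filter_fin_Ico (a := c) hle
    rw [Nat.add_sub_cancel_left] at h1
    rw [← h1]
    congr 1
    ext j
    simp only [mem_nonNbr, mem_filter, mem_univ, true_and]
    have hgu := hgc u hu
    constructor
    · rintro ⟨⟨hj, hj'⟩, -, hA⟩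
      rw [hS _ _ (Fin.lt_def.2 (by omega)), if_neg (by omega), if_pos hj', henum u hu,
        e.weight_eq hH] at hA
      omega
    · rintro ⟨hj, hj'⟩
      refine ⟨⟨hj, by omega⟩, fun h => by rw [h] at hj; omega, ?_⟩
      rw [hS _ _ (Fin.lt_def.2 (by omega)), if_neg (by omega), if_pos (by omega), henum u hu,
        e.weight_eq hH]
      omega
  · rw [card_filter_fin_Ico le_rfl]
    omega

/-- The kernel is equivalent to the instance. -/
theorem exists_isSol_iff (e : TableEqs n k α adj nonadj) (hH : Represents H adj nonadj) :
    (∃ D, IsSol (tableGraph α) D (α 14 0)) ↔ ∃ C, IsSol H C k := by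
  by_cases hno : α 12 0 = 0
  · have hm : 2 * (α 14 0) + SplitKernel.miss H (forcedIn H k) = 2 * k := by
      have h1 : ¬ (9 * k + 1 < α 10 0 ∨ 2 * k < α 11 0) := fun h => e.no.2 h hno
      have h2 := e.miss_eq hH
      have h3 := miss_eq_two_mul (G := H) (forcedIn H k)
      rw [e.param, if_neg (by simpa using hno)]
      omega
    obtain ⟨P, Q, R, g, hg⟩ := e.exists_isGadget hH hno
    rw [hg.exists_isSol_iff hm]
    exact ⟨fun ⟨X, hX⟩ => hX.exists_isSol, fun ⟨C, hC⟩ => ⟨_, hC.isCoreSol⟩⟩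
  · refine ⟨fun h => absurd h (e.not_exists_isSol_of_no hno), fun ⟨C, hC⟩ => ?_⟩
    have h1 := card_core_le hC
    have h2 := miss_forcedIn_le hC
    rw [← e.size_eq hH] at h1
    rw [← e.miss_eq hH] at h2
    exact absurd (e.no.1 hno) (by omega)

theorem verts_le (e : TableEqs n k α adj nonadj)
    : α 13 0 ≤ 11 * k + 4 := by
  rw [e.verts]
  split_ifs with hno
  · omega
  · have : ¬ (9 * k + 1 < α 10 0 ∨ 2 * k < α 11 0) := fun h => hno (e.no.2 h)
    omega

theorem param_le (e : TableEqs n k α adj nonadj)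
    : α 14 0 ≤ k := by
  rw [e.param]
  split_ifs <;> omega

end TableEqs

/-! ### The two problems -/

theorem isSplitGraph_compl {V : Type*} {G : SimpleGraph V} : IsSplitGraph Gᶜ ↔ IsSplitGraph G := by
  have h : ∀ G : SimpleGraph V, IsSplitGraph G → IsSplitGraph Gᶜ := by
    rintro G ⟨K, h1, h2⟩
    exact ⟨Kᶜ, by rwa [SimpleGraph.isClique_compl], by
      rwa [compl_compl, SimpleGraph.isIndepSet_compl]⟩
  exact ⟨fun hG => compl_compl G ▸ h _ hG, h G⟩

theorem splitAddition_iff (n : ℕ) (G : SimpleGraph (Fin n)) [DecidableRel G.Adj] (k : ℕ) :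
    SplitAddition ⟨n, G, k⟩ ↔ ∃ C, IsSol G C k := (exists_isSol_iff k).symm

/-- Deleting edges of `G` adds them to the complement. Conversely, pairs in `F` that are already
edges of the complement change nothing and are discarded. -/
theorem splitDeletion_iff (n : ℕ) (G : SimpleGraph (Fin n)) (k : ℕ) :
    SplitDeletion ⟨n, G, k⟩ ↔ SplitAddition ⟨n, Gᶜ, k⟩ := by
  classical
  have hcompl : ∀ F : Set (Sym2 (Fin n)),
      (G.deleteEdges F)ᶜ = Gᶜ ⊔ SimpleGraph.fromEdgeSet (F ∩ G.edgeSet) := by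
    intro F
    ext u v
    simp only [SimpleGraph.compl_adj, SimpleGraph.deleteEdges_adj, SimpleGraph.sup_adj,
      SimpleGraph.fromEdgeSet_adj, Set.mem_inter_iff, SimpleGraph.mem_edgeSet]
    have := G.ne_of_adj (a := u) (b := v)
    tauto
  constructor
  · rintro ⟨F, h1, h2, h3⟩
    refine ⟨F, fun e he => SimpleGraph.not_isDiag_of_mem_edgeSet _ (h1 e he), h2, ?_⟩
    rw [← isSplitGraph_compl, hcompl, Set.inter_eq_left.2 fun e he => h1 e he] at h3
    exact h3
  · rintro ⟨F, h1, h2, h3⟩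
    refine ⟨F.filter (· ∈ G.edgeSet), fun e he => (mem_filter.1 he).2,
      (card_filter_le _ _).trans h2, ?_⟩
    rw [← isSplitGraph_compl, hcompl]
    convert h3 using 1
    ext u v
    have hF := h1 s(u, v)
    simp only [SimpleGraph.compl_adj, SimpleGraph.sup_adj, SimpleGraph.fromEdgeSet_adj,
      Set.mem_inter_iff, SimpleGraph.mem_edgeSet, coe_filter, Set.mem_ofPred_eq, mem_coe]
    tauto

/-- `SplitDeletion` if `del` holds, and `SplitAddition` otherwise. -/
def SplitProblem (del : Bool) : GraphInstance → Prop :=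
  bif del then SplitDeletion else SplitAddition

theorem splitProblem_iff (del : Bool) (n : ℕ) (G : SimpleGraph (Fin n))
    [DecidableRel (workGraph del G).Adj] (k : ℕ) :
    SplitProblem del ⟨n, G, k⟩ ↔ ∃ C, IsSol (workGraph del G) C k := by
  rw [← splitAddition_iff]
  cases del
  · rfl
  · exact splitDeletion_iff n G k

theorem splitProblem_workGraph_iff (del : Bool) (n : ℕ) (G : SimpleGraph (Fin n))
    [DecidableRel G.Adj] (k : ℕ) :
    SplitProblem del ⟨n, workGraph del G, k⟩ ↔ ∃ C, IsSol G C k := by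
  rw [← splitAddition_iff]
  cases del
  · rfl
  · exact (splitDeletion_iff n Gᶜ k).trans (by rw [compl_compl])

/-- If `k` is at least `n * n`, the whole vertex set is a solution for both parameters. This permits
bounding the value of the parameter by a polynomial in the size. -/
theorem exists_isSol_min {n : ℕ} (H : SimpleGraph (Fin n)) [DecidableRel H.Adj] (k : ℕ) :
    (∃ C, IsSol H C (min k (n * n))) ↔ ∃ C, IsSol H C k := by
  rcases le_total k (n * n) with h | h
  · rw [min_eq_left h]
  · rw [min_eq_right h]
    have : miss H univ ≤ n * n := by
      refine (sum_le_card_nsmul _ _ n fun v _ => ?_).trans (by simp)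
      exact (card_le_card (nonNbr_subset v univ)).trans (by simp)
    exact ⟨fun ⟨C, hC⟩ => ⟨C, hC.1, hC.2.trans (by omega)⟩,
      fun _ => ⟨univ, fun u hu => absurd (mem_univ u) hu, by omega⟩⟩

/-- The two problems have kernels with at most `11 * k + 4` vertices. -/
theorem admitsKernel_splitProblem (del : Bool) {f : ℕ → ℝ}
    (hf : ∀ k K : ℕ, k ≤ K → 11 * (k : ℝ) + 4 ≤ f K) : AdmitsKernel (SplitProblem del) f := by
  classical
  obtain ⟨P, hP⟩ := exists_polynomial_runs_kernelProg del
  refine ⟨kernelProg del, P, fun I => ?_⟩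
  obtain ⟨σ, t, h1, h2, h3, h4, h5, h6⟩ := hP I
  have hF : Filled del I.n (min I.k (I.n * I.n)) σ.arr := h6
  have hadj := hF.adj I h5
  have e := hF.tableEqs
  have hnon : ∀ u v : Fin I.n, ((if (if (v : ℕ) = u then 1 else 0) = 0 then 1 else 0) *
      if σ.arr 2 (u * I.n + v) = 0 then 1 else 0) =
      if v ≠ u ∧ ¬ (workGraph del I.graph).Adj u v then 1 else 0 := by
    intro u v
    simp only [hadj, Fin.val_inj]
    by_cases h1 : v = u <;> by_cases h2 : (workGraph del I.graph).Adj u v <;> simp [h1, h2]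
  refine ⟨⟨σ.arr 13 0, workGraph del (tableGraph σ.arr), σ.arr 14 0⟩, t, σ, h1, h2,
    ⟨h3, h4, fun u v => ?_⟩, ?_, ?_, e.param_le.trans (min_le_left _ _)⟩
  · rw [hF.output u.2 v.2]
    cases del
    · exact if_congr Iff.rfl rfl rfl
    · refine if_congr ?_ rfl rfl
      simp only [workGraph, cond_true, SimpleGraph.compl_adj, ne_eq, Fin.ext_iff]
      exact Iff.rfl
  · rw [splitProblem_workGraph_iff, show I = ⟨I.n, I.graph, I.k⟩ from rfl, splitProblem_iff,
      ← exists_isSol_min (workGraph del I.graph), ← e.exists_isSol_iff ⟨hadj, hnon⟩]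
  · refine le_trans ?_ (hf _ _ (min_le_left I.k (I.n * I.n)))
    exact_mod_cast e.verts_le

end SplitKernel

theorem theorem2 :
    AdmitsKernel SplitAddition (fun k => 11 * (k : ℝ) + 6 * Real.sqrt (2 * (k : ℝ)) + 4) ∧
    AdmitsKernel SplitDeletion (fun k => 11 * (k : ℝ) + 6 * Real.sqrt (2 * (k : ℝ)) + 4) := by
  have hf : ∀ k K : ℕ, k ≤ K →
      11 * (k : ℝ) + 4 ≤ 11 * (K : ℝ) + 6 * Real.sqrt (2 * (K : ℝ)) + 4 := by
    intro k K h
    have h1 : (k : ℝ) ≤ K := by exact_mod_cast h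
    have h2 := Real.sqrt_nonneg (2 * (K : ℝ))
    linarith
  exact ⟨SplitKernel.admitsKernel_splitProblem false hf,
    SplitKernel.admitsKernel_splitProblem true hf⟩
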